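/- **Setting.** Let $\mathcal A=\{r,y,b,g\}$ and let $\mathbb Z^2$ act on $\mathcal A^{\mathbb Z^2}$ (product topology) by $(\gamma\omega)(x)=\omega(x-\gamma)$. The chair tiling substitution is given by the rule $$r\mapsto\begin{smallmatrix}y&r\\ r&g\end{smallmatrix},\qquad y\mapsto\begin{smallmatrix}y&b\\ r&y\end{smallmatrix},\qquad b\mapsto\begin{smallmatrix}y&b\\ b&g\end{smallmatrix},\qquad g\mapsto\begin{smallmatrix}g&b\\ r&g\end{smallmatrix},$$ where each block is a map $S_0(a):F=\{0,1\}^2\to\mathcal A$, drawn with the first coordinate to the right and the second one upwards. It acts on patches $P:M\to\mathcal A$, $M\subseteq\mathbb Z^2$ (in particular on configurations) by $S(P)(2\eta+f)=S_0(P(\eta))(f)$ for $\eta\in M$, $f\in F$. A patch $P$ occurs in a patch $Q$ if some translate of $P$ is a restriction of $Q$. A finite patch is *$S$-legal* if it occurs in $S^n(a)$ for some letter $a$ and some $n\ge1$; $W(S)$ is the set of $S$-legal patches, and $\Omega(S)$ is the set of all $\omega\in\mathcal A^{\mathbb Z^2}$ all of whose finite patches are $S$-legal. A *subshift* is a closed,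 nonempty, translation-invariant subset of $\mathcal A^{\mathbb Z^2}$; $\overline{\mathrm{Orb}(\omega)}$ is the orbit closure of $\omega$. Subshifts converge in the Hausdorff metric of a metric on $\mathcal A^{\mathbb Z^2}$ inducing the product topology (any such metric may be taken). Let $T=\{-1,0\}^2$. Let $d$ be a translation-invariant proper metric on $\mathbb Z^2$ whose open balls $B(x,r)=\{y\in\mathbb Z^2: d(x,y)<r\}$ are convex, in the sense that they contain every lattice point of the segment between any two of their points (for example $d(x,y)=\|x-y\|$ for any norm on $\mathbb R^2$). A *finite-range Schrödinger operator* is a family $H=(H_\omega)_{\omega\in\mathcal A^{\mathbb Z^2}}$ of self-adjoint operators on $\ell^2(\mathbb Z^2)$ of the form $$(H_\omega\psi)(\gamma)=\sum_{\eta\in B}t_\eta(-\gamma\,\omega)\,\psi(\gamma+\eta),$$ where $-\gamma\,\omega$ is $\omega$ translated by $-\gamma$, $B=-B\subseteq\mathbb Z^2$ is finite, and the $t_\eta:\mathcal A^{\mathbb Z^2}\to\mathbb C$ are continuous with $t_\eta(\omega)=\overline{t_{-\eta}(-\eta\,\omega)}$ for all $\omega$. Denote by $\sigma$ the spectrum and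 by $\sigma_{\mathrm{ess}}$ the essential spectrum (the spectrum without the isolated eigenvalues of finite multiplicity). **Corollary.** For every $\omega_0\in\mathcal A^{\mathbb Z^2}$ the following assertions hold. (a) There exist $k=k(\omega_0)\ge1$ and $S$-fixed points $\rho_1,\dots,\rho_k\in\mathcal A^{\mathbb Z^2}$ (that is, $S(\rho_j)=\rho_j$), not depending on $d$, such that for all $j$ $$x\in\mathbb Z^2,\ r\ge1,\ B(x,r)\cap T=\emptyset\ \Longrightarrow\ \rho_j|_{B(x,r)}\in W(S),$$ and such that $\Theta_n:=\overline{\mathrm{Orb}(S^n(\omega_0))}$ converges as $n\to\infty$ to the subshift $$\Omega_0=\bigcup_{j=1}^k\overline{\mathrm{Orb}(\rho_j)}.$$ (b) For every finite-range Schrödinger operator $H$, every $\rho\in\Omega_0$ and every $\omega\in\Omega(S)$, $$\sigma_{\mathrm{ess}}(H_\rho)=\sigma_{\mathrm{ess}}(H_\omega)\qquad\text{and}\qquad \mathrm{Leb}\bigl(\sigma(H_\rho)\,\Delta\,\sigma(H_\omega)\bigr)=0 .$$ -/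

import Mathlib

open scoped ENNReal

namespace ChairTiling

/-! ### Letters, configurations, patches -/

/-- The alphabet of the chair tiling. -/
inductive Letter where
  | r | y | b | g

instance : Finite Letter :=
  Finite.of_surjective (fun i : Fin 4 => ![Letter.r, .y, .b, .g] i) (by
    rintro (_ | _ | _ | _)
    exacts [⟨0, rfl⟩, ⟨1, rfl⟩, ⟨2, rfl⟩, ⟨3, rfl⟩])

/-- The alphabet is discrete. -/
instance : TopologicalSpace Letter := ⊥

instance : DiscreteTopology Letter := ⟨rfl⟩

/-- Configurations; they carry the product topology. -/
abbrev Config : Type := ℤ × ℤ → Letter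

/-- Patches `P : M → Letter` with `M ⊆ ℤ²`, as partial functions: `P x = none` off the support. -/
abbrev Patch : Type := ℤ × ℤ → Option Letter

/-- The support of a patch. -/
def Patch.supp (P : Patch) : Set (ℤ × ℤ) := {x | P x ≠ none}

/-- The patch with support `{0}` and the letter `a` there. -/
def letterPatch (a : Letter) : Patch := fun x => if x = 0 then some a else none

open Classical in
/-- The restriction of a configuration to a set `M`. -/
noncomputable def restrict (ω : Config) (M : Set (ℤ × ℤ)) : Patch :=
  fun x => if x ∈ M then some (ω x) else none

/-- `P ≺ Q`: some translateConfig of `P` is a restriction of `Q`. -/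
def Subpatch (P Q : Patch) : Prop :=
  ∃ γ : ℤ × ℤ, ∀ x ∈ P.supp, Q (γ + x) = P x

/-- A configuration regarded as a patch with full support. -/
def toPatch (ω : Config) : Patch := fun x => some (ω x)

/-! ### The chair tiling substitution -/

/-- The `2 × 2`-block on `F = {0,1}²` with top row `tl tr` and bottom row `bl br`; the first
coordinate points to the right and the second one upwards.  Only its values on `F` are used. -/
def block (tl tr bl br : Letter) : ℤ × ℤ → Letter := fun f =>
  if f.1 = 0 then (if f.2 = 0 then bl else tl) else (if f.2 = 0 then br else tr)

/-- The substitution rule of the chair tiling. -/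
def chairRule : Letter → ℤ × ℤ → Letter
  | .r => block .y .r
                .r .g
  | .y => block .y .b
                .r .y
  | .b => block .y .b
                .b .g
  | .g => block .g .b
                .r .g

/-- The element `η` with `γ ∈ 2 η + F` (integer division rounds down). -/
def cell (γ : ℤ × ℤ) : ℤ × ℤ := (γ.1 / 2, γ.2 / 2)

/-- The element `γ - 2 η` of `F`, where `γ ∈ 2 η + F`. -/
def offset (γ : ℤ × ℤ) : ℤ × ℤ := (γ.1 % 2, γ.2 % 2)

/-- The substitution map on patches: letterwise application of the rule. -/
def substPatch (P : Patch) : Patch := fun γ =>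
  (P (cell γ)).map fun a => chairRule a (offset γ)

/-- The substitution map on configurations. -/
def subst (ω : Config) : Config := fun γ => chairRule (ω (cell γ)) (offset γ)

theorem toPatch_subst (ω : Config) : toPatch (subst ω) = substPatch (toPatch ω) := rfl

/-- `P` is a legal patch: it has finite support and occurs in an iterate of a letter. -/
def IsLegal (P : Patch) : Prop :=
  P.supp.Finite ∧ ∃ n : ℕ, 1 ≤ n ∧ ∃ a : Letter, Subpatch P (substPatch^[n] (letterPatch a))

/-- The subshift `Ω(S)`: all finite patches of the configuration are legal. -/
def chairSubshift : Set Config :=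
  {ω | ∀ P : Patch, P.supp.Finite → Subpatch P (toPatch ω) → IsLegal P}

/-! ### Subshifts and their convergence -/

/-- The translation action `(γ ω)(x) = ω (x - γ)`. -/
def translateConfig (γ : ℤ × ℤ) (ω : Config) : Config := fun x => ω (x - γ)

theorem continuous_translateConfig (γ : ℤ × ℤ) : Continuous (translateConfig γ) :=
  continuous_pi fun x => continuous_apply (x - γ)

/-- A subshift is a closed, nonempty, translation-invariant set of configurations. -/
structure Subshift where
  carrier : Set Config
  isClosed : IsClosed carrier
  nonempty : carrier.Nonempty
  invariant : ∀ γ : ℤ × ℤ, ∀ ω ∈ carrier, translateConfig γ ω ∈ carrier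

/-- The orbit closure of a configuration. -/
def orbitClosure (ω : Config) : Subshift where
  carrier := closure (Set.range fun γ => translateConfig γ ω)
  isClosed := isClosed_closure
  nonempty := ⟨translateConfig 0 ω, subset_closure ⟨0, rfl⟩⟩
  invariant := by
    intro γ ξ hξ
    refine map_mem_closure (continuous_translateConfig γ) hξ ?_
    rintro _ ⟨δ, rfl⟩
    refine ⟨δ + γ, ?_⟩
    funext x
    simp only [translateConfig]
    congr 1
    abel

/-- Convergence of subshifts: convergence in the Hausdorff metric, for every metric on the
configuration space that induces the product topology. -/
def Subshift.ConvergesTo (Θ : ℕ → Subshift) (Ω : Subshift) : Prop :=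
  ∀ d : MetricSpace Config,
    d.toUniformSpace.toTopologicalSpace = (Pi.topologicalSpace : TopologicalSpace Config) →
    Filter.Tendsto
      (fun n => @Metric.hausdorffDist Config d.toPseudoMetricSpace (Θ n).carrier Ω.carrier)
      Filter.atTop (nhds 0)

/-! ### Balls in `ℤ²` -/

/-- The open ball of centre `x` and radius `r` for a metric `d` on `ℤ²`. -/
def ballOf (d : MetricSpace (ℤ × ℤ)) (x : ℤ × ℤ) (r : ℝ) : Set (ℤ × ℤ) := {y | d.dist x y < r}

/-- The inclusion of `ℤ²` into `ℝ²`. -/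
def toPlane (x : ℤ × ℤ) : ℝ × ℝ := (x.1, x.2)

/-- A translation-invariant proper metric on `ℤ²` with convex balls: a ball contains every
lattice point of the segment between any two of its points.  The metric `d x y = ‖x - y‖` is of
this kind for every norm on `ℝ²`. -/
structure IsConvexMetric (d : MetricSpace (ℤ × ℤ)) : Prop where
  translation_invariant : ∀ g x y : ℤ × ℤ, d.dist (g + x) (g + y) = d.dist x y
  proper : ∀ (x : ℤ × ℤ) (r : ℝ), (ballOf d x r).Finite
  convex : ∀ (x : ℤ × ℤ) (r : ℝ), ∀ u ∈ ballOf d x r, ∀ v ∈ ballOf d x r, ∀ w : ℤ × ℤ,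
    toPlane w ∈ segment ℝ (toPlane u) (toPlane v) → w ∈ ballOf d x r

/-- The testing domain `T = {-1,0}²`. -/
def testDomain : Set (ℤ × ℤ) := ({-1, 0} : Set ℤ) ×ˢ ({-1, 0} : Set ℤ)

/-! ### Schrödinger operators of finite range -/

/-- The Hilbert space `ℓ²(ℤ²)`. -/
abbrev EllTwo : Type := lp (fun _ : ℤ × ℤ => ℂ) 2

theorem memℓp_weightedShift (c : ℤ × ℤ → ℂ) {C : ℝ} (hc : ∀ γ, ‖c γ‖ ≤ C) (η : ℤ × ℤ)
    (ψ : EllTwo) : Memℓp (fun γ => c γ * ψ (γ + η)) 2 ∧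
      ∑' γ, ‖c γ * ψ (γ + η)‖ ^ (2 : ℝ≥0∞).toReal ≤ (C * ‖ψ‖) ^ (2 : ℝ≥0∞).toReal := by
  have h2 : (0 : ℝ) < (2 : ℝ≥0∞).toReal := by norm_num
  have hC : 0 ≤ C := (norm_nonneg _).trans (hc 0)
  have hs : HasSum (fun γ => C ^ (2 : ℝ≥0∞).toReal * ‖ψ (γ + η)‖ ^ (2 : ℝ≥0∞).toReal)
      (C ^ (2 : ℝ≥0∞).toReal * ‖ψ‖ ^ (2 : ℝ≥0∞).toReal) :=
    ((Equiv.addRight η).hasSum_iff.2 (lp.hasSum_norm h2 ψ)).mul_left _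
  have hle : ∀ γ, ‖c γ * ψ (γ + η)‖ ^ (2 : ℝ≥0∞).toReal ≤
      C ^ (2 : ℝ≥0∞).toReal * ‖ψ (γ + η)‖ ^ (2 : ℝ≥0∞).toReal := by
    intro γ
    rw [← Real.mul_rpow hC (norm_nonneg _), norm_mul]
    exact Real.rpow_le_rpow (by positivity)
      (mul_le_mul_of_nonneg_right (hc γ) (norm_nonneg _)) h2.le
  have hsum : Summable fun γ => ‖c γ * ψ (γ + η)‖ ^ (2 : ℝ≥0∞).toReal :=
    Summable.of_nonneg_of_le (fun γ => by positivity) hle hs.summable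
  refine ⟨memℓp_gen hsum, ?_⟩
  rw [Real.mul_rpow hC (norm_nonneg _), ← hs.tsum_eq]
  exact hsum.tsum_le_tsum hle hs.summable

/-- The bounded operator `ψ ↦ (γ ↦ c γ * ψ (γ + η))` on `ℓ²(ℤ²)`, for a bounded weight `c`. -/
noncomputable def weightedShift (c : ℤ × ℤ → ℂ) {C : ℝ} (hc : ∀ γ, ‖c γ‖ ≤ C) (η : ℤ × ℤ) :
    EllTwo →L[ℂ] EllTwo :=
  LinearMap.mkContinuous
    { toFun := fun ψ => ⟨fun γ => c γ * ψ (γ + η), (memℓp_weightedShift c hc η ψ).1⟩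
      map_add' := fun ψ φ => by ext γ; exact mul_add _ _ _
      map_smul' := fun z ψ => by ext γ; exact mul_left_comm _ _ _ }
    C (fun ψ => lp.norm_le_of_tsum_le (by norm_num)
      (mul_nonneg ((norm_nonneg _).trans (hc 0)) (norm_nonneg _))
      (memℓp_weightedShift c hc η ψ).2)

/-- The data of a Schrödinger operator of finite range over the configurations: a finite
symmetric set `range ⊆ ℤ²` and continuous coefficients `t η`, `η ∈ range`, with the symmetry
relation that makes the operators self-adjoint (the values of `t` off `range` are not used). -/
structure SchrodingerOperator where
  range : Finset (ℤ × ℤ)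
  neg_mem : ∀ η ∈ range, -η ∈ range
  t : ℤ × ℤ → C(Config, ℂ)
  symm : ∀ η ∈ range, ∀ ω : Config, t η ω = starRingEnd ℂ (t (-η) (translateConfig (-η) ω))

namespace SchrodingerOperator

variable (H : SchrodingerOperator)

/-- The operator `H_ω`, see `op_apply`. -/
noncomputable def op (ω : Config) : EllTwo →L[ℂ] EllTwo :=
  ∑ η ∈ H.range, weightedShift (fun γ => H.t η (translateConfig (-γ) ω))
    (fun γ => (H.t η).norm_coe_le_norm (translateConfig (-γ) ω)) η

theorem op_apply (ω : Config) (ψ : EllTwo) (γ : ℤ × ℤ) :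
    H.op ω ψ γ = ∑ η ∈ H.range, H.t η (translateConfig (-γ) ω) * ψ (γ + η) := by
  simp only [op, sum_apply, lp.coeFn_sum, Finset.sum_apply]
  rfl

theorem isSelfAdjoint_op (ω : Config) : IsSelfAdjoint (H.op ω) := by
  rw [ContinuousLinearMap.isSelfAdjoint_iff_isSymmetric]
  intro ψ φ
  have hs : ∀ (c : ℤ × ℤ → ℂ) (C : ℝ) (hc : ∀ γ, ‖c γ‖ ≤ C) (η : ℤ × ℤ),
      inner ℂ (weightedShift c hc η ψ) φ =
        ∑' γ, inner ℂ (c (γ - η) * ψ γ) (φ (γ - η)) := by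
    intro c C hc η
    rw [lp.inner_eq_tsum, ← (Equiv.subRight η).tsum_eq]
    congr 1; ext γ
    change inner ℂ (c (γ - η) * ψ (γ - η + η)) _ = _
    simp
  change inner ℂ (H.op ω ψ) φ = inner ℂ ψ (H.op ω φ)
  simp only [SchrodingerOperator.op, sum_apply, sum_inner, inner_sum]
  refine Finset.sum_bij' (fun η _ => -η) (fun η _ => -η) H.neg_mem H.neg_mem (by simp) (by simp) ?_
  intro η hη
  rw [hs, lp.inner_eq_tsum]
  congr 1; ext γ
  change _ = inner ℂ (ψ γ) (H.t (-η) (translateConfig (-γ) ω) * φ (γ + -η))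
  rw [H.symm η hη]
  have : translateConfig (-η) (translateConfig (-(γ - η)) ω) = translateConfig (-γ) ω := by
    funext x; simp only [translateConfig]; congr 1; abel
  rw [this]
  simp [sub_eq_add_neg]; ring

end SchrodingerOperator

/-! ### Spectra -/

section Spectrum

variable {E : Type*} [NormedAddCommGroup E] [NormedSpace ℂ E]

/-- The real points of the spectrum; for a self-adjoint operator, this is the spectrum. -/
def realSpectrum (A : E →L[ℂ] E) : Set ℝ := {x | (x : ℂ) ∈ spectrum ℂ A}

/-- The discrete spectrum of a self-adjoint operator: the isolated points of the spectrum that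
are eigenvalues of finite multiplicity. -/
def discreteSpectrum (A : E →L[ℂ] E) : Set ℝ :=
  {x | x ∈ realSpectrum A ∧ (∃ ε > 0, ∀ z ∈ realSpectrum A, |z - x| < ε → z = x) ∧
    Module.End.HasEigenvalue (A : E →ₗ[ℂ] E) (x : ℂ) ∧
    FiniteDimensional ℂ (Module.End.eigenspace (A : E →ₗ[ℂ] E) (x : ℂ))}

/-- The essential spectrum of a self-adjoint operator. -/
def essSpectrum (A : E →L[ℂ] E) : Set ℝ := realSpectrum A \ discreteSpectrum A

end Spectrum

end ChairTiling

open ChairTiling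

namespace ChairTiling

/-! ### Letters -/

/-! Part (a) rests on the idempotence `chairRule_idem`. The cells of `testDomain` are fixed by
`cell`, so the letters there are constant after one substitution, and the iterates of a
configuration converge pointwise to a fixed point `substLimit` that depends only on the four letters
around the origin. The `ρ j` are the limits obtained from all translates of `ω₀`; there are finitely
many. Their patterns occur in high iterates because iteration turns a translation by `u` into one by
`2 ^ n • u`. Conversely, a bounded window of a high iterate meets only the supertiles around one
vertex. Tracing this vertex back through the levels ends either at a vertex of `ω₀`, or at a vertex
with an odd coordinate, whose pattern occurs in every fixed point (`exists_vertex`).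

Legality comes from the rigidity of fixed points. Two of them agree off the lines `x.1 = x.2` and
`x.1 + x.2 = -1`, and each is constant on either half of either line. A legal fixed point exists for
every choice of one half of each line and of the admissible letters there (`exists_legal_fixed`).
Hence a finite pattern can be illegal only if it meets both halves of one of the lines, which a
convex set disjoint from `testDomain` cannot do (`exists_occursIn_of_convex`).

For (b), the essential spectrum is described by approximate eigenvectors vanishing on any prescribed
finite set (`mem_essSpectrum_iff`). For finite range, these can be cut down to squares of a size
depending only on the error, and moved to any place with the same surrounding pattern. Legal
patterns recur off every finite set, while `ξ` in the limit subshift has only finitely many illegal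
squares of each size. So `σ_ess(H_ξ) ⊆ σ(H_ω) ⊆ σ_ess(H_ω)` and `σ_ess(H_ω) ⊆ σ(H_ω) ⊆ σ_ess(H_ξ)`.
The spectra then differ only by discrete spectrum, which is countable. -/

instance : DecidableEq Letter := fun c d => by
  cases c <;> cases d <;> first | exact isTrue rfl | exact isFalse (fun h => by cases h)

instance : Fintype Letter := ⟨{.r, .y, .b, .g}, fun a => by cases a <;> decide⟩

/-- This is what makes the iterates converge rather than become merely eventually periodic: a
position fixed by `cell` sees the same `f` at every level. -/
theorem chairRule_idem (a : Letter) (f : ℤ × ℤ) :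
    chairRule (chairRule a f) f = chairRule a f := by
  cases a <;> simp only [chairRule, block] <;> split_ifs <;> simp_all [block]

/-! ### Iterates of the substitution -/

theorem cell_iterate (n : ℕ) (x : ℤ × ℤ) : cell^[n] x = (x.1 / 2 ^ n, x.2 / 2 ^ n) := by
  induction n with
  | zero => simp
  | succ n ih =>
    rw [Function.iterate_succ_apply', ih]
    simp only [cell, pow_succ]
    rw [Int.ediv_ediv_of_nonneg (by positivity), Int.ediv_ediv_of_nonneg (by positivity)]

theorem subst_iterate_succ (n : ℕ) (ω : Config) (x : ℤ × ℤ) :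
    subst^[n + 1] ω x = chairRule (subst^[n] ω (cell x)) (offset x) := by
  rw [Function.iterate_succ_apply']; rfl

theorem cell_smul_add (c x : ℤ × ℤ) : cell ((2 : ℤ) • c + x) = c + cell x := by
  ext <;> simp [cell] <;> omega

theorem offset_smul_add (c x : ℤ × ℤ) : offset ((2 : ℤ) • c + x) = offset x := by
  ext <;> simp [offset]

theorem cell_iterate_smul_add (n : ℕ) (c x : ℤ × ℤ) :
    cell^[n] ((2 ^ n : ℤ) • c + x) = c + cell^[n] x := by
  induction n generalizing x with
  | zero => simp
  | succ n ih =>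
    rw [Function.iterate_succ_apply, Function.iterate_succ_apply, pow_succ', mul_smul,
      cell_smul_add, ih]

/-- The `n`-th iterate of the substitution is determined supertile by supertile. -/
theorem subst_iterate_eq {n : ℕ} {ω ω' : Config} {c c' x : ℤ × ℤ}
    (h : ω (c + cell^[n] x) = ω' (c' + cell^[n] x)) :
    subst^[n] ω ((2 ^ n : ℤ) • c + x) = subst^[n] ω' ((2 ^ n : ℤ) • c' + x) := by
  induction n generalizing x with
  | zero => simpa using h
  | succ n ih =>
    rw [subst_iterate_succ, subst_iterate_succ, pow_succ', mul_smul, mul_smul, cell_smul_add,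
      cell_smul_add, offset_smul_add, offset_smul_add, ih]
    exact h

theorem subst_iterate_congr {n : ℕ} {ω ω' : Config} {x : ℤ × ℤ}
    (h : ω (cell^[n] x) = ω' (cell^[n] x)) : subst^[n] ω x = subst^[n] ω' x := by
  simpa using subst_iterate_eq (n := n) (ω := ω) (ω' := ω') (c := 0) (c' := 0) (x := x) (by simpa)

theorem subst_iterate_shift (n : ℕ) (ω : Config) (c x : ℤ × ℤ) :
    subst^[n] ω ((2 ^ n : ℤ) • c + x) = subst^[n] (fun y => ω (c + y)) x := by
  simpa using subst_iterate_eq (n := n) (ω := ω) (ω' := fun y => ω (c + y)) (c := c) (c' := 0)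
    (x := x) (by simp)

/-! ### The limits of the iterates -/

theorem mem_testDomain {x : ℤ × ℤ} :
    x ∈ testDomain ↔ (x.1 = -1 ∨ x.1 = 0) ∧ (x.2 = -1 ∨ x.2 = 0) := by
  simp [testDomain]

theorem cell_of_mem_testDomain {x : ℤ × ℤ} (hx : x ∈ testDomain) : cell x = x := by
  rw [mem_testDomain] at hx
  ext <;> simp [cell] <;> omega

theorem ediv_two_pow_mem {k : ℤ} {n : ℕ} (h : k.natAbs ≤ 2 ^ n) (h' : k ≠ 2 ^ n) :
    k / 2 ^ n = -1 ∨ k / 2 ^ n = 0 := by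
  have h2 : (0 : ℤ) < 2 ^ n := by positivity
  zify at h
  rcases lt_or_ge k 0 with hk | hk
  · left
    rw [abs_of_neg hk] at h
    rw [Int.ediv_eq_iff_of_pos h2]
    constructor <;> linarith
  · right
    rw [abs_of_nonneg hk] at h
    exact Int.ediv_eq_zero_of_lt hk (lt_of_le_of_ne h h')

theorem cell_iterate_mem {x : ℤ × ℤ} {n : ℕ} (h1 : x.1.natAbs ≤ n) (h2 : x.2.natAbs ≤ n) :
    cell^[n] x ∈ testDomain := by
  have hn : n < 2 ^ n := Nat.lt_two_pow_self
  rw [mem_testDomain, cell_iterate]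
  exact ⟨ediv_two_pow_mem (by omega) (fun h => by rw [h] at h1; simp [Int.natAbs_pow] at h1; omega),
    ediv_two_pow_mem (by omega) (fun h => by rw [h] at h2; simp [Int.natAbs_pow] at h2; omega)⟩

/-- The letter at `x` is computed from the one at the ancestor `cell^[m] x`, which is its own cell
and hence stable from the first substitution on. -/
theorem subst_iterate_stable {ω : Config} {x : ℤ × ℤ} {m n : ℕ} (hx : cell^[m] x ∈ testDomain)
    (hmn : m < n) : subst^[n] ω x = subst^[m + 1] ω x := by
  obtain ⟨k, rfl⟩ := Nat.exists_eq_add_of_lt hmn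
  rw [show m + k + 1 = m + (k + 1) by ring, Function.iterate_add_apply,
    Function.iterate_add_apply _ m 1]
  apply subst_iterate_congr
  generalize cell^[m] x = t at hx
  clear hmn
  induction k with
  | zero => rfl
  | succ k ih =>
    rw [subst_iterate_succ, cell_of_mem_testDomain hx, ih, Function.iterate_one]
    simp only [subst, cell_of_mem_testDomain hx, chairRule_idem]

/-- The pointwise limit of the iterates of the substitution. -/
def substLimit (ω : Config) : Config := fun x => subst^[max x.1.natAbs x.2.natAbs + 1] ω x

theorem substLimit_eq (ω : Config) {x : ℤ × ℤ} {m n : ℕ} (hx : cell^[m] x ∈ testDomain)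
    (hmn : m < n) : subst^[n] ω x = substLimit ω x := by
  have hx' := cell_iterate_mem (x := x) (le_max_left _ _) (le_max_right _ _)
  rw [substLimit, ← subst_iterate_stable hx' (lt_of_lt_of_le (Nat.lt_succ_self _)
    (le_max_right n _)), subst_iterate_stable hx hmn,
    subst_iterate_stable hx (hmn.trans_le (le_max_left _ _))]

theorem eventually_substLimit (ω : Config) (x : ℤ × ℤ) :
    ∀ᶠ n in Filter.atTop, subst^[n] ω x = substLimit ω x := by
  filter_upwards [Filter.eventually_gt_atTop (max x.1.natAbs x.2.natAbs)] with n hn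
  exact substLimit_eq ω (cell_iterate_mem (le_max_left _ _) (le_max_right _ _)) hn

theorem substLimit_testDomain (ω : Config) {t : ℤ × ℤ} (ht : t ∈ testDomain) :
    substLimit ω t = chairRule (ω t) (offset t) := by
  rw [← substLimit_eq ω (m := 0) (n := 1) ht one_pos, Function.iterate_one, subst,
    cell_of_mem_testDomain ht]

theorem subst_substLimit (ω : Config) : subst (substLimit ω) = substLimit ω := by
  funext x
  obtain ⟨n, h1, h2⟩ := ((eventually_substLimit ω (cell x)).and
    ((Filter.tendsto_add_atTop_nat 1).eventually (eventually_substLimit ω x))).exists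
  rw [← h2, subst_iterate_succ, h1]; rfl

theorem substLimit_congr {ω ω' : Config} (h : ∀ t ∈ testDomain, ω t = ω' t) :
    substLimit ω = substLimit ω' := by
  funext x
  obtain ⟨n, h1, h2, h3⟩ := ((eventually_substLimit ω x).and
    ((eventually_substLimit ω' x).and (Filter.eventually_ge_atTop
    (max x.1.natAbs x.2.natAbs)))).exists
  rw [← h1, ← h2]
  exact subst_iterate_congr (h _ (cell_iterate_mem (le_of_max_le_left h3) (le_of_max_le_right h3)))

theorem subst_iterate_of_fixed {ρ : Config} (h : subst ρ = ρ) (n : ℕ) : subst^[n] ρ = ρ :=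
  Function.iterate_fixed h n

/-! ### The fixed points along the diagonals and off the diagonals -/

/-- All four blocks carry `r` or `b` on the diagonal and `y` or `g` on the antidiagonal, so the
parity of a position restricts its letter to two values. -/
theorem subst_even {ω : Config} {x : ℤ × ℤ} (h : (x.1 + x.2) % 2 = 0) :
    subst ω x = .r ∨ subst ω x = .b := by
  rw [subst]
  simp only [offset]
  rcases Int.emod_two_eq_zero_or_one x.1 with h1 | h1 <;>
  rcases Int.emod_two_eq_zero_or_one x.2 with h2 | h2 <;> rw [h1, h2] <;>
  first | omega | (cases ω (cell x) <;> simp [chairRule, block])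

theorem subst_odd {ω : Config} {x : ℤ × ℤ} (h : (x.1 + x.2) % 2 = 1) :
    subst ω x = .y ∨ subst ω x = .g := by
  rw [subst]
  simp only [offset]
  rcases Int.emod_two_eq_zero_or_one x.1 with h1 | h1 <;>
  rcases Int.emod_two_eq_zero_or_one x.2 with h2 | h2 <;> rw [h1, h2] <;>
  first | omega | (cases ω (cell x) <;> simp [chairRule, block])

/-- The blocks of `r` and `b` differ only on the diagonal, where each letter copies itself; those of
`y` and `g` differ only on the antidiagonal, with the same effect. Information thus travels only
along the two lines. -/
theorem chairRule_diag_eq {a : Letter} (ha : a = .r ∨ a = .b) {f : ℤ × ℤ}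
    (hf : f = (0, 0) ∨ f = (1, 1)) : chairRule a f = a := by
  rcases ha with rfl | rfl <;> rcases hf with rfl | rfl <;> rfl

theorem chairRule_antidiag_eq {a : Letter} (ha : a = .y ∨ a = .g) {f : ℤ × ℤ}
    (hf : f = (0, 1) ∨ f = (1, 0)) : chairRule a f = a := by
  rcases ha with rfl | rfl <;> rcases hf with rfl | rfl <;> rfl

theorem chairRule_off_diag {a a' : Letter} (ha : a = .r ∨ a = .b) (ha' : a' = .r ∨ a' = .b)
    {f : ℤ × ℤ} (hf : f = (0, 1) ∨ f = (1, 0)) : chairRule a f = chairRule a' f := by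
  rcases ha with rfl | rfl <;> rcases ha' with rfl | rfl <;> rcases hf with rfl | rfl <;> rfl

theorem chairRule_off_antidiag {a a' : Letter} (ha : a = .y ∨ a = .g) (ha' : a' = .y ∨ a' = .g)
    {f : ℤ × ℤ} (hf : f = (0, 0) ∨ f = (1, 1)) : chairRule a f = chairRule a' f := by
  rcases ha with rfl | rfl <;> rcases ha' with rfl | rfl <;> rcases hf with rfl | rfl <;> rfl

theorem fixed_even {ρ : Config} (h : subst ρ = ρ) {x : ℤ × ℤ} (hx : (x.1 + x.2) % 2 = 0) :
    ρ x = .r ∨ ρ x = .b := by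
  rw [← h]; exact subst_even hx

theorem fixed_odd {ρ : Config} (h : subst ρ = ρ) {x : ℤ × ℤ} (hx : (x.1 + x.2) % 2 = 1) :
    ρ x = .y ∨ ρ x = .g := by
  rw [← h]; exact subst_odd hx

/-- Induction along `cell`. If the cell of `x` is on one of the lines but `x` is not, the offset of
`x` is one where the two admissible letters of the cell give the same result. -/
theorem fixed_off_diag {ρ ρ' : Config} (h : subst ρ = ρ) (h' : subst ρ' = ρ') (x : ℤ × ℤ)
    (h1 : x.1 ≠ x.2) (h2 : x.1 + x.2 ≠ -1) : ρ x = ρ' x := by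
  induction hN : x.1.natAbs + x.2.natAbs using Nat.strong_induction_on generalizing x with
  | _ N ih =>
  rw [← h, ← h']
  simp only [subst]
  by_cases hd : (cell x).1 = (cell x).2
  · have he : ((cell x).1 + (cell x).2) % 2 = 0 := by omega
    apply chairRule_off_diag (fixed_even h he) (fixed_even h' he)
    simp only [cell, offset, Prod.mk.injEq] at *
    omega
  by_cases ha : (cell x).1 + (cell x).2 = -1
  · have he : ((cell x).1 + (cell x).2) % 2 = 1 := by omega
    apply chairRule_off_antidiag (fixed_odd h he) (fixed_odd h' he)
    simp only [cell, offset, Prod.mk.injEq] at *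
    omega
  rw [ih _ _ (cell x) hd ha rfl]
  simp only [cell] at *
  omega

theorem fixed_diag {ρ : Config} (h : subst ρ = ρ) (k : ℤ) :
    ρ (k, k) = ρ (if 0 ≤ k then 0 else -1, if 0 ≤ k then 0 else -1) := by
  induction hN : k.natAbs using Nat.strong_induction_on generalizing k with
  | _ N ih =>
  by_cases hk : k = 0 ∨ k = -1
  · rcases hk with rfl | rfl <;> rfl
  have hs : ρ (k, k) = ρ (k / 2, k / 2) := by
    conv_lhs => rw [← h]
    exact chairRule_diag_eq (fixed_even h (by simp [cell]; omega)) (by simp [offset]; omega)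
  rw [hs, ih _ (by omega) (k / 2) rfl]
  simp only [show 0 ≤ k / 2 ↔ 0 ≤ k by omega]

theorem fixed_antidiag {ρ : Config} (h : subst ρ = ρ) (k : ℤ) :
    ρ (k, -1 - k) = ρ (if 0 ≤ k then 0 else -1, if 0 ≤ k then -1 else 0) := by
  induction hN : k.natAbs using Nat.strong_induction_on generalizing k with
  | _ N ih =>
  by_cases hk : k = 0 ∨ k = -1
  · rcases hk with rfl | rfl <;> rfl
  have hs : ρ (k, -1 - k) = ρ (k / 2, -1 - k / 2) := by
    conv_lhs => rw [← h]
    have : cell (k, -1 - k) = (k / 2, -1 - k / 2) := by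
      simp only [cell, Prod.mk.injEq, true_and]; omega
    rw [subst, this]
    exact chairRule_antidiag_eq (fixed_odd h (by simp)) (by simp [offset]; omega)
  rw [hs, ih _ (by omega) (k / 2) rfl]
  simp only [show 0 ≤ k / 2 ↔ 0 ≤ k by omega]

/-! ### Occurrences in supertiles -/

/-- The pattern of `ω` on `M` occurs in the supertile of level `n` and type `a`. -/
def OccursIn (M : Set (ℤ × ℤ)) (ω : Config) (n : ℕ) (a : Letter) : Prop :=
  ∃ γ : ℤ × ℤ, ∀ x ∈ M, cell^[n] (γ + x) = 0 ∧ subst^[n] (fun _ => a) (γ + x) = ω x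

/-- All finite patterns of the configuration occur in supertiles. -/
def IsLegalConfig (ω : Config) : Prop :=
  ∀ M : Set (ℤ × ℤ), M.Finite → ∃ n a, OccursIn M ω n a

theorem substPatch_iterate_letterPatch (n : ℕ) (a : Letter) (x : ℤ × ℤ) :
    substPatch^[n] (letterPatch a) x =
      if cell^[n] x = 0 then some (subst^[n] (fun _ => a) x) else none := by
  induction n generalizing x with
  | zero => by_cases hx : x = 0 <;> simp [letterPatch, hx]
  | succ n ih =>
    rw [Function.iterate_succ_apply', substPatch, ih, Function.iterate_succ_apply cell,
      subst_iterate_succ]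
    split_ifs <;> simp

theorem supp_restrict (ω : Config) (M : Set (ℤ × ℤ)) : (restrict ω M).supp = M := by
  ext x; simp [Patch.supp, restrict]

theorem subpatch_restrict_iff {M : Set (ℤ × ℤ)} {ω : Config} {n : ℕ} {a : Letter} :
    Subpatch (restrict ω M) (substPatch^[n] (letterPatch a)) ↔ OccursIn M ω n a := by
  simp only [Subpatch, OccursIn, supp_restrict]
  refine exists_congr fun γ => forall₂_congr fun x hx => ?_
  rw [substPatch_iterate_letterPatch, restrict, if_pos hx]
  simp

theorem OccursIn.of_iterate {M : Set (ℤ × ℤ)} {ω : Config} {n k : ℕ} {a c : Letter}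
    (h : OccursIn M ω n a) {p : ℤ × ℤ} (hp : cell^[k] p = 0)
    (hp' : subst^[k] (fun _ => c) p = a) : OccursIn M ω (n + k) c := by
  obtain ⟨γ, hγ⟩ := h
  refine ⟨(2 ^ n : ℤ) • p + γ, fun x hx => ?_⟩
  obtain ⟨h1, h2⟩ := hγ x hx
  rw [add_assoc]
  constructor
  · rw [add_comm n k, Function.iterate_add_apply, cell_iterate_smul_add, h1, add_zero, hp]
  · rw [Function.iterate_add_apply, subst_iterate_shift, ← h2]
    apply subst_iterate_congr
    rw [h1, add_zero, hp']

theorem exists_letter_in_supertile (c a : Letter) :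
    ∃ p : ℤ × ℤ, cell^[2] p = 0 ∧ subst^[2] (fun _ => c) p = a := by
  cases c <;> cases a <;> first
    | exact ⟨(0, 0), by decide⟩
    | exact ⟨(0, 1), by decide⟩
    | exact ⟨(1, 0), by decide⟩
    | exact ⟨(1, 3), by decide⟩
    | exact ⟨(0, 2), by decide⟩

/-- Primitivity: a legal pattern occurs in all supertiles of sufficiently high level. -/
theorem OccursIn.forall_letter {M : Set (ℤ × ℤ)} {ω : Config} {n : ℕ} {a : Letter}
    (h : OccursIn M ω n a) (c : Letter) : OccursIn M ω (n + 2) c := by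
  obtain ⟨p, hp, hp'⟩ := exists_letter_in_supertile c a
  exact h.of_iterate hp hp'

theorem isLegal_restrict {M : Set (ℤ × ℤ)} (hM : M.Finite) {ω : Config} {n : ℕ} {a : Letter}
    (h : OccursIn M ω n a) : IsLegal (restrict ω M) :=
  ⟨by rwa [supp_restrict], n + 2, by omega, a, subpatch_restrict_iff.2 (h.forall_letter a)⟩

theorem isLegalConfig_of_mem {ω : Config} (h : ω ∈ chairSubshift) : IsLegalConfig ω := by
  intro M hM
  obtain ⟨-, n, -, a, ha⟩ := h (restrict ω M) (by rwa [supp_restrict])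
    ⟨0, fun x hx => by rw [supp_restrict] at hx; simp [toPatch, restrict, hx]⟩
  exact ⟨n, a, subpatch_restrict_iff.1 ha⟩

theorem OccursIn.mono {M M' : Set (ℤ × ℤ)} {ω ω' : Config} {n : ℕ} {a : Letter}
    (h : OccursIn M ω n a) (hM : M' ⊆ M) (hω : ∀ x ∈ M', ω x = ω' x) : OccursIn M' ω' n a := by
  obtain ⟨γ, hγ⟩ := h
  exact ⟨γ, fun x hx => ⟨(hγ x (hM hx)).1, (hγ x (hM hx)).2.trans (hω x hx)⟩⟩

theorem OccursIn.shift {M : Set (ℤ × ℤ)} {ω ω' : Config} {n : ℕ} {a : Letter} (δ : ℤ × ℤ)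
    (h : OccursIn ((δ + ·) '' M) ω n a) (hω : ∀ x ∈ M, ω (δ + x) = ω' x) : OccursIn M ω' n a := by
  obtain ⟨γ, hγ⟩ := h
  refine ⟨γ + δ, fun x hx => ?_⟩
  rw [add_assoc, ← hω x hx]
  exact hγ _ ⟨x, hx, rfl⟩

/-! ### Configurations that are locally composed of supertiles -/

/-- All finite patterns of `ξ` occur in configurations composed of supertiles of level `m`. -/
def LocallySubst (m : ℕ) (ξ : Config) : Prop :=
  ∀ W : Set (ℤ × ℤ), W.Finite → ∃ (ζ : Config) (δ : ℤ × ℤ), ∀ x ∈ W, ξ x = subst^[m] ζ (δ + x)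

theorem locallySubst_of_fixed {ρ : Config} (h : subst ρ = ρ) (m : ℕ) : LocallySubst m ρ :=
  fun _ _ => ⟨ρ, 0, fun x _ => by rw [subst_iterate_of_fixed h, zero_add]⟩

theorem IsLegalConfig.locallySubst {ω : Config} (h : IsLegalConfig ω) (m : ℕ) :
    LocallySubst m ω := by
  intro W hW
  obtain ⟨n, a, hn⟩ := h W hW
  obtain ⟨γ, hγ⟩ := (hn.forall_letter _).of_iterate (k := m) (p := 0) (c := a)
    (Function.iterate_fixed rfl m) rfl
  -- The pattern was put into the supertile of the letter at `0` of `S^m(a)`, so that it occurs at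
  -- level `n + 2 + m`; the outer `m` substitutions are then split off.
  refine ⟨subst^[n + 2] (fun _ => a), γ, fun x hx => ?_⟩
  rw [← Function.iterate_add_apply, add_comm m, (hγ x hx).2]

/-- The square `[a₁, a₁ + R) × [a₂, a₂ + R)`. -/
def box (a : ℤ × ℤ) (R : ℕ) : Set (ℤ × ℤ) := Set.Ico a.1 (a.1 + R) ×ˢ Set.Ico a.2 (a.2 + R)

theorem mem_box {a x : ℤ × ℤ} {R : ℕ} : x ∈ box a R ↔
    (a.1 ≤ x.1 ∧ x.1 < a.1 + R) ∧ (a.2 ≤ x.2 ∧ x.2 < a.2 + R) := by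
  simp [box]

theorem finite_box (a : ℤ × ℤ) (R : ℕ) : (box a R).Finite :=
  (Set.finite_Ico _ _).prod (Set.finite_Ico _ _)

theorem exists_subset_box {M : Set (ℤ × ℤ)} (hM : M.Finite) :
    ∃ R : ℕ, M ⊆ box (-R, -R) (2 * R + 1) := by
  obtain ⟨B, hB⟩ := (hM.image fun x => max x.1.natAbs x.2.natAbs).bddAbove
  refine ⟨B, fun x hx => ?_⟩
  have := hB ⟨x, hx, rfl⟩
  rw [mem_box]
  simp only at *
  omega

/-- Patterns that occur in all supertiles of level `m` occur off every finite set in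
configurations composed of supertiles of level `m`. -/
theorem LocallySubst.exists_occurrence {m : ℕ} {ξ ω : Config} (hξ : LocallySubst m ξ)
    {M K : Set (ℤ × ℤ)} (h : ∀ c, OccursIn M ω m c) (hK : K.Finite) :
    ∃ γ : ℤ × ℤ, (∀ x ∈ M, γ + x ∉ K) ∧ ∀ x ∈ M, ξ (γ + x) = ω x := by
  obtain ⟨B, hB⟩ := exists_subset_box hK
  have h2 : (0 : ℤ) < 2 ^ m := by positivity
  -- A square of twice the side of a supertile contains a whole supertile, the one at `v` below;
  -- starting at `B + 1` keeps it away from `K`.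
  obtain ⟨ζ, δ, hζ⟩ := hξ (box (B + 1, B + 1) (2 * 2 ^ m)) (finite_box _ _)
  obtain ⟨γ, hγ⟩ := h (ζ ((δ.1 + (B + 1)) / 2 ^ m + 1, (δ.2 + (B + 1)) / 2 ^ m + 1))
  set v : ℤ × ℤ := ((δ.1 + (B + 1)) / 2 ^ m + 1, (δ.2 + (B + 1)) / 2 ^ m + 1) with hv
  have key : ∀ x ∈ M, (2 ^ m : ℤ) • v + γ - δ + x ∈ box (B + 1, B + 1) (2 * 2 ^ m) := by
    intro x hx
    have h1 := (hγ x hx).1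
    rw [cell_iterate, Prod.ext_iff] at h1
    have e1 := (Int.ediv_eq_iff_of_pos h2).1 h1.1
    have e2 := (Int.ediv_eq_iff_of_pos h2).1 h1.2
    have f1 := Int.mul_ediv_add_emod (δ.1 + (B + 1)) (2 ^ m)
    have f2 := Int.mul_ediv_add_emod (δ.2 + (B + 1)) (2 ^ m)
    have g1 := Int.emod_nonneg (δ.1 + (B + 1)) h2.ne'
    have g2 := Int.emod_nonneg (δ.2 + (B + 1)) h2.ne'
    have g3 := Int.emod_lt_of_pos (δ.1 + (B + 1)) h2
    have g4 := Int.emod_lt_of_pos (δ.2 + (B + 1)) h2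
    rw [mem_box]
    simp only [hv, Prod.fst_add, Prod.snd_add, Prod.fst_sub, Prod.snd_sub, Prod.smul_fst,
      Prod.smul_snd, smul_eq_mul, Prod.fst_zero, Prod.snd_zero] at *
    push_cast
    refine ⟨⟨?_, ?_⟩, ?_, ?_⟩ <;> linarith
  refine ⟨(2 ^ m : ℤ) • v + γ - δ, fun x hx hxK => ?_, fun x hx => ?_⟩
  · have h1 := mem_box.1 (hB hxK)
    have h2 := mem_box.1 (key x hx)
    simp only at h1 h2
    push_cast at h1
    omega
  · rw [hζ _ (key x hx), ← (hγ x hx).2]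
    have e : δ + ((2 ^ m : ℤ) • v + γ - δ + x) = (2 ^ m : ℤ) • v + (γ + x) := by abel
    rw [e, subst_iterate_shift]
    apply subst_iterate_congr
    rw [(hγ x hx).1, add_zero]

/-! ### Legal fixed points -/

/-- The four letters around `c` lie in one supertile, and every finite part of the limit lies in a
high iterate of these four letters, hence in a larger supertile. -/
theorem isLegalConfig_substLimit (n : ℕ) (a : Letter) (c : ℤ × ℤ)
    (hc : ∀ t ∈ testDomain, cell^[n] (c + t) = 0) :
    IsLegalConfig (substLimit fun y => subst^[n] (fun _ => a) (c + y)) := by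
  intro M hM
  obtain ⟨R, hR⟩ := exists_subset_box hM
  obtain ⟨N, h1, h2⟩ := (((Filter.eventually_all_finite hM).2 fun x _ =>
    eventually_substLimit (fun y => subst^[n] (fun _ => a) (c + y)) x).and
    (Filter.eventually_ge_atTop R)).exists
  refine ⟨N + n, a, (2 ^ N : ℤ) • c, fun x hx => ⟨?_, ?_⟩⟩
  · have h3 := mem_box.1 (hR hx)
    rw [add_comm N n, Function.iterate_add_apply, cell_iterate_smul_add, hc]
    simp only at h3
    push_cast at h3
    exact cell_iterate_mem (by omega) (by omega)
  · rw [Function.iterate_add_apply, subst_iterate_shift, h1 x hx]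

theorem exists_legal_of_vertex (c : ℤ × ℤ) (h1 : 1 ≤ c.1 ∧ c.1 ≤ 7) (h2 : 1 ≤ c.2 ∧ c.2 ≤ 7) :
    ∃ ρ : Config, subst ρ = ρ ∧ IsLegalConfig ρ ∧ ∀ t ∈ testDomain,
      ρ t = chairRule (subst^[3] (fun _ => .r) (c + t)) (offset t) := by
  refine ⟨_, subst_substLimit _, isLegalConfig_substLimit 3 .r c fun t ht => ?_,
    fun t ht => substLimit_testDomain _ ht⟩
  rw [mem_testDomain] at ht
  rw [cell_iterate]
  simp only [Prod.fst_add, Prod.snd_add, Prod.mk_eq_zero]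
  omega

theorem exists_legal_fixed {p q : Letter} (hp : p = .r ∨ p = .b) (hq : q = .y ∨ q = .g)
    {s t : ℤ × ℤ} (hs : s = (0, 0) ∨ s = (-1, -1)) (ht : t = (0, -1) ∨ t = (-1, 0)) :
    ∃ ρ : Config, subst ρ = ρ ∧ IsLegalConfig ρ ∧ ρ s = p ∧ ρ t = q := by
  have hs' : s ∈ testDomain := by rcases hs with rfl | rfl <;> simp [mem_testDomain]
  have ht' : t ∈ testDomain := by rcases ht with rfl | rfl <;> simp [mem_testDomain]
  suffices ∃ c : ℤ × ℤ, ((1 ≤ c.1 ∧ c.1 ≤ 7) ∧ (1 ≤ c.2 ∧ c.2 ≤ 7)) ∧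
      chairRule (subst^[3] (fun _ => .r) (c + s)) (offset s) = p ∧
      chairRule (subst^[3] (fun _ => .r) (c + t)) (offset t) = q by
    obtain ⟨c, ⟨h1, h2⟩, h3, h4⟩ := this
    obtain ⟨ρ, h5, h6, h7⟩ := exists_legal_of_vertex c h1 h2
    exact ⟨ρ, h5, h6, (h7 s hs').trans h3, (h7 t ht').trans h4⟩
  -- Sixteen cases; five interior vertices of the `8 × 8` supertile `S³(r)` realize them all.
  rcases hp with rfl | rfl <;> rcases hq with rfl | rfl <;> rcases hs with rfl | rfl <;>
  rcases ht with rfl | rfl <;> first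
    | exact ⟨(1, 1), by decide⟩
    | exact ⟨(1, 2), by decide⟩
    | exact ⟨(1, 3), by decide⟩
    | exact ⟨(3, 1), by decide⟩
    | exact ⟨(3, 7), by decide⟩

theorem exists_legal_fixed_edge :
    ∃ ρ : Config, subst ρ = ρ ∧ IsLegalConfig ρ ∧
      ρ (0, 0) = .r ∧ ρ (-1, -1) = .b ∧ ρ (-1, 0) = .g ∧ ρ (0, -1) = .y := by
  obtain ⟨ρ, h5, h6, h7⟩ := exists_legal_of_vertex (1, 2) (by decide) (by decide)
  refine ⟨ρ, h5, h6, ?_, ?_, ?_, ?_⟩ <;> rw [h7 _ (by simp [mem_testDomain])] <;> decide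

/-- A pattern of a fixed point is legal unless it meets both halves of a diagonal. -/
theorem exists_occursIn_of_fixed {ρ : Config} (h : subst ρ = ρ) {M : Set (ℤ × ℤ)} (hM : M.Finite)
    (hd : (∀ k : ℤ, (k, k) ∈ M → 0 ≤ k) ∨ ∀ k : ℤ, (k, k) ∈ M → ¬ 0 ≤ k)
    (ha : (∀ k : ℤ, (k, -1 - k) ∈ M → 0 ≤ k) ∨ ∀ k : ℤ, (k, -1 - k) ∈ M → ¬ 0 ≤ k) :
    ∃ n a, OccursIn M ρ n a := by
  obtain ⟨s, hs, hs'⟩ : ∃ s : ℤ × ℤ, (s = (0, 0) ∨ s = (-1, -1)) ∧ ∀ k : ℤ, (k, k) ∈ M →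
      ∀ ρ : Config, subst ρ = ρ → ρ (k, k) = ρ s := by
    rcases hd with hd | hd
    · exact ⟨_, .inl rfl, fun k hk ρ hρ => by rw [fixed_diag hρ, if_pos (hd k hk)]⟩
    · exact ⟨_, .inr rfl, fun k hk ρ hρ => by rw [fixed_diag hρ, if_neg (hd k hk)]⟩
  obtain ⟨t, ht, ht'⟩ : ∃ t : ℤ × ℤ, (t = (0, -1) ∨ t = (-1, 0)) ∧ ∀ k : ℤ, (k, -1 - k) ∈ M →
      ∀ ρ : Config, subst ρ = ρ → ρ (k, -1 - k) = ρ t := by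
    rcases ha with ha | ha
    · exact ⟨_, .inl rfl, fun k hk ρ hρ => by
        rw [fixed_antidiag hρ, if_pos (ha k hk), if_pos (ha k hk)]⟩
    · exact ⟨_, .inr rfl, fun k hk ρ hρ => by
        rw [fixed_antidiag hρ, if_neg (ha k hk), if_neg (ha k hk)]⟩
  -- The legal fixed point `ρ'` shares with `ρ` the letters on the half-lines that `M` may meet, so
  -- the two agree on all of `M`.
  obtain ⟨ρ', h1, h2, h3, h4⟩ := exists_legal_fixed (p := ρ s) (q := ρ t)
    (fixed_even h (by rcases hs with rfl | rfl <;> rfl))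
    (fixed_odd h (by rcases ht with rfl | rfl <;> rfl)) hs ht
  obtain ⟨n, a, hn⟩ := h2 M hM
  refine ⟨n, a, hn.mono subset_rfl fun x hx => ?_⟩
  obtain ⟨k, l⟩ := x
  by_cases e1 : k = l
  · subst e1
    rw [hs' k hx ρ' h1, hs' k hx ρ h, h3]
  by_cases e2 : k + l = -1
  · obtain rfl : l = -1 - k := by omega
    rw [ht' k hx ρ' h1, ht' k hx ρ h, h4]
  exact fixed_off_diag h1 h _ e1 e2

theorem exists_occursIn_of_convex {ρ : Config} (h : subst ρ = ρ) {M : Set (ℤ × ℤ)} (hM : M.Finite)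
    (hconv : ∀ u ∈ M, ∀ v ∈ M, ∀ w : ℤ × ℤ,
      toPlane w ∈ segment ℝ (toPlane u) (toPlane v) → w ∈ M)
    (hT : M ∩ testDomain = ∅) : ∃ n a, OccursIn M ρ n a := by
  have key : ∀ (f : ℤ → ℤ × ℤ) (e : ℝ × ℝ), (∀ k, toPlane (f k) = toPlane (f 0) + (k : ℝ) • e) →
      f 0 ∈ testDomain → (∀ k, f k ∈ M → 0 ≤ k) ∨ ∀ k, f k ∈ M → ¬ 0 ≤ k := by
    intro f e hf h0
    by_contra! hcon
    obtain ⟨⟨k, hk, hk'⟩, l, hl, hl'⟩ := hcon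
    have h0M : f 0 ∈ M := by
      refine hconv _ hk _ hl _ ?_
      have hk0 : (k : ℝ) < 0 := by exact_mod_cast hk'
      have hl0 : (0 : ℝ) ≤ l := by exact_mod_cast hl'
      have hlk : (0 : ℝ) < l - k := by linarith
      -- These weights make the parameters `k < 0 ≤ l` average to `0`.
      refine ⟨l / (l - k), -k / (l - k), by positivity, div_nonneg (by linarith) hlk.le,
        by field_simp; ring, ?_⟩
      rw [hf k, hf l]
      simp only [smul_add, smul_smul]
      rw [add_add_add_comm, ← add_smul, ← add_smul]
      have e1 : (l : ℝ) / (l - k) + -k / (l - k) = 1 := by field_simp; ring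
      have e2 : (l : ℝ) / (l - k) * k + -k / (l - k) * l = 0 := by field_simp; ring
      rw [e1, e2, one_smul, zero_smul, add_zero]
    exact Set.disjoint_left.1 (Set.disjoint_iff_inter_eq_empty.2 hT) h0M h0
  refine exists_occursIn_of_fixed h hM (key (fun k => (k, k)) (1, 1) ?_ ?_)
    (key (fun k => (k, -1 - k)) (1, -1) ?_ ?_)
  · intro k; simp [toPlane]
  · simp [mem_testDomain]
  · intro k; simp [toPlane]; ring
  · simp [mem_testDomain]

/-- A product of intervals that meets both halves of either line contains the origin, a point of
`testDomain`. -/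
theorem exists_occursIn_box {ρ : Config} (h : subst ρ = ρ) {a : ℤ × ℤ} {R : ℕ}
    (hT : box a R ∩ testDomain = ∅) : ∃ n c, OccursIn (box a R) ρ n c := by
  have h1 : (0, 0) ∉ box a R := fun h1 =>
    Set.disjoint_left.1 (Set.disjoint_iff_inter_eq_empty.2 hT) h1 (by simp [mem_testDomain])
  rw [mem_box] at h1
  refine exists_occursIn_of_fixed h (finite_box a R) ?_ ?_
  · by_contra! hcon
    obtain ⟨⟨k, hk, hk'⟩, l, hl, hl'⟩ := hcon
    rw [mem_box] at hk hl
    simp only at *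
    omega
  · by_contra! hcon
    obtain ⟨⟨k, hk, hk'⟩, l, hl, hl'⟩ := hcon
    rw [mem_box] at hk hl
    simp only at *
    omega

/-! ### The product topology on configurations -/

theorem mem_nhds_config {U : Set Config} {ω : Config} :
    U ∈ nhds ω ↔ ∃ M : Set (ℤ × ℤ), M.Finite ∧ ∀ ω' : Config, (∀ x ∈ M, ω' x = ω x) → ω' ∈ U := by
  rw [nhds_pi, Filter.mem_pi]
  constructor
  · rintro ⟨M, hM, t, ht, hU⟩
    refine ⟨M, hM, fun ω' h => hU fun x hx => ?_⟩
    rw [h x hx]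
    exact mem_of_mem_nhds (ht x)
  · rintro ⟨M, hM, hU⟩
    exact ⟨M, hM, fun x => {ω x}, fun x => by simp [nhds_discrete], fun ω' h => hU ω' h⟩

theorem mem_orbitClosure {ω ξ : Config} : ξ ∈ (orbitClosure ω).carrier ↔
    ∀ M : Set (ℤ × ℤ), M.Finite → ∃ γ : ℤ × ℤ, ∀ x ∈ M, ξ x = ω (γ + x) := by
  rw [orbitClosure, mem_closure_iff_nhds]
  constructor
  · intro h M hM
    obtain ⟨_, h1, γ, rfl⟩ := h {ω' | ∀ x ∈ M, ω' x = ξ x}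
      (mem_nhds_config.2 ⟨M, hM, fun _ h => h⟩)
    exact ⟨-γ, fun x hx => (h1 x hx).symm.trans (congrArg ω (sub_eq_neg_add x γ))⟩
  · intro h U hU
    obtain ⟨M, hM, hMU⟩ := mem_nhds_config.1 hU
    obtain ⟨γ, hγ⟩ := h M hM
    refine ⟨_, hMU (translateConfig (-γ) ω) fun x hx => ?_, -γ, rfl⟩
    rw [hγ x hx, translateConfig, sub_neg_eq_add, add_comm]

/-- A relation that holds locally near the diagonal holds for all pairs of configurations that
agree on a suitable finite set. -/
theorem exists_finite_of_forall_nhds {r : Config → Config → Prop}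
    (h : ∀ ω, ∃ U ∈ nhds ω, ∀ ω' ∈ U, ∀ ω'' ∈ U, r ω' ω'') :
    ∃ M : Set (ℤ × ℤ), M.Finite ∧ ∀ ω' ω'' : Config, (∀ x ∈ M, ω' x = ω'' x) → r ω' ω'' := by
  have h' : ∀ ω : Config, ∃ M : Set (ℤ × ℤ), M.Finite ∧ ∀ ω' ω'' : Config,
      (∀ x ∈ M, ω' x = ω x) → (∀ x ∈ M, ω'' x = ω x) → r ω' ω'' := by
    intro ω
    obtain ⟨U, hU, hr⟩ := h ω
    obtain ⟨M, hM, hMU⟩ := mem_nhds_config.1 hU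
    exact ⟨M, hM, fun ω' ω'' h1 h2 => hr _ (hMU _ h1) _ (hMU _ h2)⟩
  choose M hM hr using h'
  obtain ⟨s, -, hs⟩ := isCompact_univ.elim_nhds_subcover
    (fun ω : Config => {ω' | ∀ x ∈ M ω, ω' x = ω x})
    fun ω _ => mem_nhds_config.2 ⟨M ω, hM ω, fun _ h => h⟩
  refine ⟨⋃ ω ∈ s, M ω, s.finite_toSet.biUnion fun ω _ => hM ω, fun ω' ω'' h => ?_⟩
  obtain ⟨ω, hω, h1⟩ := Set.mem_iUnion₂.1 (hs (Set.mem_univ ω'))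
  exact hr ω ω' ω'' h1 fun x hx => by
    rw [← h x (Set.mem_biUnion hω hx), h1 x hx]

/-- By compactness, for any compatible metric, agreement on a suitable finite window forces a small
distance uniformly. -/
theorem convergesTo_of_patterns {Θ : ℕ → Subshift} {Ω : Subshift}
    (h : ∀ M : Set (ℤ × ℤ), M.Finite → ∀ᶠ n in Filter.atTop,
      (∀ ξ ∈ (Θ n).carrier, ∃ ζ ∈ Ω.carrier, ∀ x ∈ M, ξ x = ζ x) ∧
      ∀ ζ ∈ Ω.carrier, ∃ ξ ∈ (Θ n).carrier, ∀ x ∈ M, ζ x = ξ x) :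
    Subshift.ConvergesTo Θ Ω := by
  intro d hd
  rw [Metric.tendsto_atTop]
  intro ε hε
  obtain ⟨M, hM, hMd⟩ := exists_finite_of_forall_nhds (r := fun ω' ω'' => d.dist ω' ω'' ≤ ε / 2)
    (by
      intro ω
      have hb := @Metric.ball_mem_nhds Config d.toPseudoMetricSpace ω (ε / 4) (by positivity)
      rw [hd] at hb
      refine ⟨_, hb, fun ω' h1 ω'' h2 => ?_⟩
      have h1' : d.dist ω' ω < ε / 4 := h1
      have h2' : d.dist ω'' ω < ε / 4 := h2
      have h3 := d.dist_triangle ω' ω ω''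
      rw [d.dist_comm ω ω''] at h3
      linarith)
  obtain ⟨N, hN⟩ := Filter.eventually_atTop.1 (h M hM)
  refine ⟨N, fun n hn => ?_⟩
  have key : @Metric.hausdorffDist Config d.toPseudoMetricSpace (Θ n).carrier Ω.carrier ≤ ε / 2 := by
    apply @Metric.hausdorffDist_le_of_mem_dist Config d.toPseudoMetricSpace
    · positivity
    · intro ξ hξ
      obtain ⟨ζ, hζ, h1⟩ := (hN n hn).1 ξ hξ
      exact ⟨ζ, hζ, hMd _ _ h1⟩
    · intro ζ hζ
      obtain ⟨ξ, hξ, h1⟩ := (hN n hn).2 ζ hζ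
      exact ⟨ξ, hξ, hMd _ _ h1⟩
  rw [Real.dist_eq, sub_zero, abs_of_nonneg (@Metric.hausdorffDist_nonneg Config
    d.toPseudoMetricSpace _ _)]
  linarith

theorem mem_orbitClosure_self (ω : Config) : ω ∈ (orbitClosure ω).carrier :=
  mem_orbitClosure.2 fun _ _ => ⟨0, fun x _ => by rw [zero_add]⟩

/-! ### Vertices of the iterates -/

/-- The pattern of `η` at the vertex `v` occurs in `ρ`, at least after one substitution. -/
def StableVertexIn (η : Config) (v : ℤ × ℤ) (ρ : Config) : Prop :=
  ∃ v' : ℤ × ℤ, ∀ t ∈ testDomain, chairRule (η (v + t)) (offset t) = ρ (v' + t)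

theorem finite_testDomain : testDomain.Finite :=
  (Set.toFinite _).prod (Set.toFinite _)

/-- A fixed point contains all patterns that occur in a legal configuration. -/
theorem IsLegalConfig.occurs {ω ρ : Config} (hω : IsLegalConfig ω) (h : subst ρ = ρ)
    {M : Set (ℤ × ℤ)} (hM : M.Finite) : ∃ γ : ℤ × ℤ, ∀ x ∈ M, ρ (γ + x) = ω x := by
  obtain ⟨n, a, ha⟩ := hω M hM
  obtain ⟨γ, -, hγ⟩ := (locallySubst_of_fixed h (n + 2)).exists_occurrence
    (fun c => ha.forall_letter c) Set.finite_empty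
  exact ⟨γ, hγ⟩

theorem exists_pair_in_fixed {ρ : Config} (h : subst ρ = ρ) {p q : Letter}
    (hp : p = .r ∨ p = .b) (hq : q = .y ∨ q = .g)
    {s t : ℤ × ℤ} (hs : s = (0, 0) ∨ s = (-1, -1)) (ht : t = (0, -1) ∨ t = (-1, 0)) :
    ∃ γ : ℤ × ℤ, ρ (γ + s) = p ∧ ρ (γ + t) = q := by
  obtain ⟨ω, -, h1, rfl, rfl⟩ := exists_legal_fixed hp hq hs ht
  obtain ⟨γ, hγ⟩ := h1.occurs h (M := {s, t}) (Set.toFinite _)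
  exact ⟨γ, hγ s (by simp), hγ t (by simp)⟩

/-- If the cells around the vertex `v` are matched by cells of a fixed point, then so is the
pattern at `v`. -/
theorem subst_match {η ρ : Config} (h : subst ρ = ρ) {v w γ : ℤ × ℤ}
    (hcell : ∀ t ∈ testDomain, η (w + cell (v - (2 : ℤ) • w + t)) =
      ρ (γ + cell (v - (2 : ℤ) • w + t))) :
    ∃ v' : ℤ × ℤ, ∀ t ∈ testDomain, subst η (v + t) = ρ (v' + t) := by
  refine ⟨(2 : ℤ) • γ + (v - (2 : ℤ) • w), fun t ht => ?_⟩
  have e : v + t = (2 : ℤ) • w + (v - (2 : ℤ) • w + t) := by abel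
  conv_rhs => rw [← h]
  rw [e, add_assoc]
  simp only [subst, cell_smul_add, offset_smul_add]
  rw [hcell t ht]

/-- The patterns of the second iterate of the substitution at vertices with an odd coordinate
occur in all fixed points. -/
theorem vertex_odd {η ρ : Config} (h : subst ρ = ρ) {v : ℤ × ℤ}
    (hv : ¬ (v.1 % 2 = 0 ∧ v.2 % 2 = 0)) :
    ∃ v' : ℤ × ℤ, ∀ t ∈ testDomain, subst (subst η) (v + t) = ρ (v' + t) := by
  have hpar : ∀ z : ℤ × ℤ, (z.1 + z.2) % 2 = 0 ∧ (subst η z = .r ∨ subst η z = .b) ∨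
      (z.1 + z.2) % 2 = 1 ∧ (subst η z = .y ∨ subst η z = .g) := by
    intro z
    rcases Int.emod_two_eq_zero_or_one (z.1 + z.2) with h0 | h0
    · exact .inl ⟨h0, subst_even h0⟩
    · exact .inr ⟨h0, subst_odd h0⟩
  suffices ∃ w γ : ℤ × ℤ, ∀ t ∈ testDomain, subst η (w + cell (v - (2 : ℤ) • w + t)) =
      ρ (γ + cell (v - (2 : ℤ) • w + t)) by
    obtain ⟨w, γ, hw⟩ := this
    exact subst_match h hw
  obtain ⟨i, j, hij⟩ : ∃ i j : ℤ, v = (2 * i + 1, 2 * j + 1) ∨ v = (2 * i, 2 * j + 1) ∨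
      v = (2 * i + 1, 2 * j) := ⟨v.1 / 2, v.2 / 2, by simp only [Prod.ext_iff]; omega⟩
  have cellT : ∀ {e f : ℤ} {t : ℤ × ℤ}, t ∈ testDomain → (e = 0 ∨ e = 1) → (f = 0 ∨ f = 1) →
      cell ((2 * i + e, 2 * j + f) - (2 : ℤ) • (i, j) + t) =
        (if e = 1 then 0 else t.1, if f = 1 then 0 else t.2) := by
    intro e f t ht he hf
    rw [mem_testDomain] at ht
    simp only [cell, Prod.fst_add, Prod.snd_add, Prod.fst_sub, Prod.snd_sub, Prod.smul_fst,
      Prod.smul_snd, smul_eq_mul, Prod.mk.injEq]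
    constructor <;> split_ifs <;> omega
  refine ⟨(i, j), ?_⟩
  rcases hij with rfl | rfl | rfl
  · obtain ⟨γ, h1⟩ : ∃ γ : ℤ × ℤ, ρ γ = subst η (i, j) := by
      rcases hpar (i, j) with ⟨-, hp⟩ | ⟨-, hp⟩
      · obtain ⟨γ, hγ, -⟩ := exists_pair_in_fixed h hp (.inl rfl) (.inl rfl) (.inl rfl)
        exact ⟨_, hγ⟩
      · obtain ⟨γ, -, hγ⟩ := exists_pair_in_fixed h (.inl rfl) hp (.inl rfl) (.inl rfl)
        exact ⟨_, hγ⟩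
    refine ⟨γ, fun t ht => ?_⟩
    have := cellT (e := 1) (f := 1) ht (by simp) (by simp)
    rw [this]
    simpa [Prod.mk_zero_zero] using h1.symm
  · obtain ⟨γ, h1, h2⟩ : ∃ γ : ℤ × ℤ, ρ γ = subst η (i, j) ∧
        ρ (γ + (-1, 0)) = subst η ((i, j) + (-1, 0)) := by
      -- Neighbouring cells have opposite parities, so two of the four cases are void. In the others
      -- the two letters form an admissible pair, one on each line, and such pairs occur in `ρ`.
      rcases hpar (i, j) with ⟨h0, hp⟩ | ⟨h0, hp⟩ <;>
      rcases hpar ((i, j) + (-1, 0)) with ⟨h1, hq⟩ | ⟨h1, hq⟩ <;>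
      first
        | (simp only [Prod.fst_add, Prod.snd_add] at h0 h1; omega)
        | skip
      · obtain ⟨γ, hγ, hγ'⟩ := exists_pair_in_fixed h hp hq (.inl rfl) (.inr rfl)
        exact ⟨γ, by simpa [Prod.mk_zero_zero] using hγ, hγ'⟩
      · obtain ⟨γ, hγ, hγ'⟩ := exists_pair_in_fixed h hq hp (.inr rfl) (.inl rfl)
        exact ⟨_, hγ', by rw [add_assoc]; exact hγ⟩
    refine ⟨γ, fun t ht => ?_⟩
    have := cellT (e := 0) (f := 1) ht (by simp) (by simp)
    rw [add_zero] at this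
    rw [this]
    rcases (mem_testDomain.1 ht).1 with e | e <;> simp only [e]
    · simpa using h2.symm
    · simpa [Prod.mk_zero_zero] using h1.symm
  · obtain ⟨γ, h1, h2⟩ : ∃ γ : ℤ × ℤ, ρ γ = subst η (i, j) ∧
        ρ (γ + (0, -1)) = subst η ((i, j) + (0, -1)) := by
      rcases hpar (i, j) with ⟨h0, hp⟩ | ⟨h0, hp⟩ <;>
      rcases hpar ((i, j) + (0, -1)) with ⟨h1, hq⟩ | ⟨h1, hq⟩ <;>
      first
        | (simp only [Prod.fst_add, Prod.snd_add] at h0 h1; omega)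
        | skip
      · obtain ⟨γ, hγ, hγ'⟩ := exists_pair_in_fixed h hp hq (.inl rfl) (.inl rfl)
        exact ⟨γ, by simpa [Prod.mk_zero_zero] using hγ, hγ'⟩
      · obtain ⟨γ, hγ, hγ'⟩ := exists_pair_in_fixed h hq hp (.inr rfl) (.inr rfl)
        exact ⟨_, hγ', by rw [add_assoc]; exact hγ⟩
    refine ⟨γ, fun t ht => ?_⟩
    have := cellT (e := 1) (f := 0) ht (by simp) (by simp)
    rw [add_zero] at this
    rw [this]
    rcases (mem_testDomain.1 ht).2 with e | e <;> simp only [e]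
    · simpa using h2.symm
    · simpa [Prod.mk_zero_zero] using h1.symm

theorem testDomain_cases {t : ℤ × ℤ} (ht : t ∈ testDomain) :
    t = (0, 0) ∨ t = (-1, -1) ∨ t = (-1, 0) ∨ t = (0, -1) := by
  rw [mem_testDomain] at ht
  simp only [Prod.ext_iff]
  omega

/-- With both coordinates odd, the vertex is the centre of a single block, whose letters are already
stable. With exactly one odd, the parities are swapped, and the next substitution erases all
dependence on `η`, leaving the pattern of `exists_legal_fixed_edge`. -/
theorem stable_vertex_odd {η ρ : Config} (h : subst ρ = ρ) {v : ℤ × ℤ}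
    (hv : ¬ (v.1 % 2 = 0 ∧ v.2 % 2 = 0)) : StableVertexIn (subst η) v ρ := by
  by_cases hv' : v.1 % 2 = 1 ∧ v.2 % 2 = 1
  · obtain ⟨γ, h1⟩ : ∃ γ : ℤ × ℤ, ρ γ = η (cell v) := by
      rcases h0 : η (cell v) with _ | _ | _ | _
      · obtain ⟨γ, hγ, -⟩ := exists_pair_in_fixed h (p := .r) (q := .y)
          (by simp) (by simp) (.inl rfl) (.inl rfl)
        exact ⟨_, hγ⟩
      · obtain ⟨γ, -, hγ⟩ := exists_pair_in_fixed h (p := .r) (q := .y)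
          (by simp) (by simp) (.inl rfl) (.inl rfl)
        exact ⟨_, hγ⟩
      · obtain ⟨γ, hγ, -⟩ := exists_pair_in_fixed h (p := .b) (q := .y)
          (by simp) (by simp) (.inl rfl) (.inl rfl)
        exact ⟨_, hγ⟩
      · obtain ⟨γ, -, hγ⟩ := exists_pair_in_fixed h (p := .r) (q := .g)
          (by simp) (by simp) (.inl rfl) (.inl rfl)
        exact ⟨_, hγ⟩
    refine ⟨(2 : ℤ) • γ + (1, 1), fun t ht => ?_⟩
    conv_rhs => rw [← h]
    have ht' := mem_testDomain.1 ht
    have e1 : cell (v + t) = cell v := by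
      simp only [cell, Prod.fst_add, Prod.snd_add, Prod.mk.injEq]; omega
    have e2 : cell ((1, 1) + t) = 0 := by
      simp only [cell, Prod.fst_add, Prod.snd_add, Prod.mk_eq_zero]; omega
    have e3 : offset (v + t) = offset ((1, 1) + t) := by
      simp only [offset, Prod.fst_add, Prod.snd_add, Prod.mk.injEq]; omega
    rw [add_assoc]
    simp only [subst, cell_smul_add, offset_smul_add]
    rw [e1, e2, e3, add_zero, h1]
    generalize η (cell v) = a
    rcases testDomain_cases ht with rfl | rfl | rfl | rfl <;> cases a <;> rfl
  · obtain ⟨ω, -, hω, h1, h2, h3, h4⟩ := exists_legal_fixed_edge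
    obtain ⟨γ, hγ⟩ := hω.occurs h finite_testDomain
    refine ⟨γ, fun t ht => ?_⟩
    rw [hγ t ht]
    have hpar : (v.1 + v.2) % 2 = 1 := by omega
    rcases testDomain_cases ht with rfl | rfl | rfl | rfl
    · rw [h1]
      rcases subst_odd (ω := η) (x := v + (0, 0)) (by simpa using hpar) with e | e <;> rw [e] <;> rfl
    · rw [h2]
      rcases subst_odd (ω := η) (x := v + (-1, -1))
        (by simp only [Prod.fst_add, Prod.snd_add]; omega) with e | e <;> rw [e] <;> rfl
    · rw [h3]
      rcases subst_even (ω := η) (x := v + (-1, 0))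
        (by simp only [Prod.fst_add, Prod.snd_add]; omega) with e | e <;> rw [e] <;> rfl
    · rw [h4]
      rcases subst_even (ω := η) (x := v + (0, -1))
        (by simp only [Prod.fst_add, Prod.snd_add]; omega) with e | e <;> rw [e] <;> rfl

theorem subst_even_vertex {η : Config} {v t : ℤ × ℤ} (hv : v.1 % 2 = 0 ∧ v.2 % 2 = 0)
    (ht : t ∈ testDomain) : subst η (v + t) = chairRule (η (cell v + t)) (offset t) := by
  have e : v = (2 : ℤ) • cell v := by
    simp only [cell, Prod.ext_iff, Prod.smul_fst, Prod.smul_snd, smul_eq_mul]; omega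
  conv_lhs => rw [e]
  rw [subst, cell_smul_add, offset_smul_add, cell_of_mem_testDomain ht]

/-- Descent through the levels: an even vertex comes from the vertex `cell v` one level below, and
idempotence absorbs the extra substitution; an odd vertex ends the descent. -/
theorem exists_stableVertex (ω₀ : Config) (k : ℕ) (v : ℤ × ℤ) :
    ∃ u : ℤ × ℤ, StableVertexIn (subst^[k] ω₀) v (substLimit fun y => ω₀ (u + y)) := by
  induction k generalizing v with
  | zero => exact ⟨v, 0, fun t ht => by rw [zero_add, substLimit_testDomain _ ht]; rfl⟩
  | succ k ih =>
    rw [Function.iterate_succ_apply']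
    by_cases hv : v.1 % 2 = 0 ∧ v.2 % 2 = 0
    · obtain ⟨u, v', h⟩ := ih (cell v)
      exact ⟨u, v', fun t ht => by rw [subst_even_vertex hv ht, chairRule_idem, h t ht]⟩
    · exact ⟨0, stable_vertex_odd (subst_substLimit _) hv⟩

theorem exists_vertex (ω₀ : Config) (k : ℕ) (v : ℤ × ℤ) :
    ∃ u v' : ℤ × ℤ, ∀ t ∈ testDomain,
      subst^[k + 2] ω₀ (v + t) = substLimit (fun y => ω₀ (u + y)) (v' + t) := by
  rw [Function.iterate_succ_apply']
  by_cases hv : v.1 % 2 = 0 ∧ v.2 % 2 = 0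
  · obtain ⟨u, v', h⟩ := exists_stableVertex ω₀ (k + 1) (cell v)
    exact ⟨u, v', fun t ht => by rw [subst_even_vertex hv ht, h t ht]⟩
  · rw [Function.iterate_succ_apply']
    exact ⟨0, vertex_odd (subst_substLimit _) hv⟩

/-! ### Convergence of the iterates -/

/-- Eventually, the patterns of the iterates occur in the limits of the iterates. -/
theorem eventually_pattern_in_substLimit (ω₀ : Config) {M : Set (ℤ × ℤ)} (hM : M.Finite) :
    ∀ᶠ n in Filter.atTop, ∀ γ : ℤ × ℤ, ∃ u γ' : ℤ × ℤ, ∀ x ∈ M,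
      subst^[n] ω₀ (γ + x) = substLimit (fun y => ω₀ (u + y)) (γ' + x) := by
  obtain ⟨R, hR⟩ := exists_subset_box hM
  set m := 2 * R + 1 with hm
  filter_upwards [Filter.eventually_ge_atTop (m + 2)] with n hn γ
  obtain ⟨k, rfl⟩ := Nat.exists_eq_add_of_le hn
  rw [show m + 2 + k = m + (k + 2) by ring]
  have h2 : (0 : ℤ) < 2 ^ m := by positivity
  have hm2 : (m : ℤ) < 2 ^ m := by exact_mod_cast Nat.lt_two_pow_self
  -- The lower left corner of the window lies in the supertile at `v - (1, 1)`. As the window has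
  -- side `m < 2 ^ m`, it stays within the four supertiles around `v`.
  set v : ℤ × ℤ := ((γ.1 - R) / 2 ^ m + 1, (γ.2 - R) / 2 ^ m + 1) with hv
  obtain ⟨u, v', h⟩ := exists_vertex ω₀ k v
  refine ⟨u, (2 ^ m : ℤ) • v' + (γ - (2 ^ m : ℤ) • v), fun x hx => ?_⟩
  have e : γ + x = (2 ^ m : ℤ) • v + (γ - (2 ^ m : ℤ) • v + x) := by abel
  conv_rhs => rw [← subst_iterate_of_fixed (subst_substLimit _) m, add_assoc]
  conv_lhs => rw [e]
  rw [Function.iterate_add_apply]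
  apply subst_iterate_eq
  apply h
  have h3 := mem_box.1 (hR hx)
  simp only at h3
  have key : ∀ g z : ℤ, -(R : ℤ) ≤ z → z < -R + (2 * R + 1) →
      (g - 2 ^ m * ((g - R) / 2 ^ m + 1) + z) / 2 ^ m = -1 ∨
      (g - 2 ^ m * ((g - R) / 2 ^ m + 1) + z) / 2 ^ m = 0 := by
    intro g z hz1 hz2
    have f1 := Int.mul_ediv_add_emod (g - R) (2 ^ m)
    have g1 := Int.emod_nonneg (g - R) h2.ne'
    have g3 := Int.emod_lt_of_pos (g - R) h2
    rw [Int.ediv_eq_iff_of_pos h2, Int.ediv_eq_iff_of_pos h2]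
    rcases lt_or_ge (g - 2 ^ m * ((g - R) / 2 ^ m + 1) + z) 0 with h0 | h0
    · left
      rw [mul_add, mul_one] at *
      constructor <;> linarith
    · right
      rw [mul_add, mul_one] at *
      push_cast [hm] at hm2
      constructor <;> linarith
  rw [mem_testDomain, cell_iterate]
  exact ⟨key γ.1 x.1 h3.1.1 h3.1.2, key γ.2 x.2 h3.2.1 h3.2.2⟩

/-- Eventually, the patterns of the limits of the iterates occur in the iterates. -/
theorem eventually_pattern_in_iterate (ω₀ : Config) {M : Set (ℤ × ℤ)} (hM : M.Finite) :
    ∀ᶠ n in Filter.atTop, ∀ u γ : ℤ × ℤ, ∃ γ' : ℤ × ℤ, ∀ x ∈ M,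
      substLimit (fun y => ω₀ (u + y)) (γ + x) = subst^[n] ω₀ (γ' + x) := by
  have : Finite M := hM
  -- The threshold depends on the position `γ`; one representative for each of the finitely many
  -- patterns on `M` makes it uniform.
  have hp : ∀ p : M → Letter, ∀ᶠ n in Filter.atTop,
      (∃ u γ : ℤ × ℤ, ∀ x : M, substLimit (fun y => ω₀ (u + y)) (γ + x) = p x) →
      ∃ γ' : ℤ × ℤ, ∀ x : M, p x = subst^[n] ω₀ (γ' + x) := by
    intro p
    by_cases h : ∃ u γ : ℤ × ℤ, ∀ x : M, substLimit (fun y => ω₀ (u + y)) (γ + x) = p x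
    · obtain ⟨u, γ, h⟩ := h
      filter_upwards [Filter.eventually_all.2 fun x : M =>
        eventually_substLimit (fun y => ω₀ (u + y)) (γ + x)] with n hn _
      refine ⟨(2 ^ n : ℤ) • u + γ, fun x => ?_⟩
      rw [add_assoc, subst_iterate_shift, hn, h]
    · exact Filter.Eventually.of_forall fun n h' => absurd h' h
  filter_upwards [Filter.eventually_all.2 hp] with n hn u γ
  obtain ⟨γ', h⟩ := hn (fun x => substLimit (fun y => ω₀ (u + y)) (γ + x)) ⟨u, γ, fun _ => rfl⟩
  exact ⟨γ', fun x hx => h ⟨x, hx⟩⟩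

/-- The translates of a configuration have finitely many limits of iterates. -/
theorem finite_range_substLimit (ω₀ : Config) :
    (Set.range fun u : ℤ × ℤ => substLimit fun y => ω₀ (u + y)).Finite := by
  have : Finite testDomain := finite_testDomain
  let f : (testDomain → Letter) → Config := fun p =>
    substLimit fun y => open Classical in if h : y ∈ testDomain then p ⟨y, h⟩ else .r
  refine (Set.finite_range f).subset ?_
  rintro _ ⟨u, rfl⟩
  exact ⟨fun t => ω₀ (u + t), substLimit_congr fun t ht => by simp [ht]⟩

/-! ### Patterns in the orbit closures of the fixed points -/

theorem LocallySubst.of_mem_orbitClosure {m : ℕ} {ρ ξ : Config} (h : LocallySubst m ρ)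
    (hξ : ξ ∈ (orbitClosure ρ).carrier) : LocallySubst m ξ := by
  intro W hW
  obtain ⟨γ, hγ⟩ := mem_orbitClosure.1 hξ W hW
  obtain ⟨ζ, δ, hζ⟩ := h ((γ + ·) '' W) (hW.image _)
  exact ⟨ζ, δ + γ, fun x hx => by rw [hγ x hx, hζ _ ⟨x, hx, rfl⟩, add_assoc]⟩

theorem image_add_box (γ a : ℤ × ℤ) (R : ℕ) : (γ + ·) '' box a R = box (γ + a) R := by
  ext x
  constructor
  · rintro ⟨y, hy, rfl⟩
    rw [mem_box] at *
    simp only [Prod.fst_add, Prod.snd_add]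
    omega
  · intro hx
    refine ⟨x - γ, ?_, by simp⟩
    rw [mem_box] at *
    simp only [Prod.fst_add, Prod.snd_add, Prod.fst_sub, Prod.snd_sub] at *
    omega

/-- Only finitely many squares of a given size carry an illegal pattern. -/
theorem finite_illegal_boxes {ρ ξ : Config} (h : subst ρ = ρ)
    (hξ : ξ ∈ (orbitClosure ρ).carrier) (R : ℕ) :
    {a : ℤ × ℤ | ¬ ∃ n c, OccursIn (box a R) ξ n c}.Finite := by
  rcases Set.eq_empty_or_nonempty {a : ℤ × ℤ | ¬ ∃ n c, OccursIn (box a R) ξ n c} with h0 | ⟨a₀, h0⟩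
  · rw [h0]; exact Set.finite_empty
  refine (finite_box (a₀ - ((R : ℤ) + 2, (R : ℤ) + 2)) (2 * R + 5)).subset fun a ha => ?_
  -- Both illegal squares are found in `ρ` under one translation, where each must meet `testDomain`;
  -- this bounds their distance.
  obtain ⟨γ, hγ⟩ := mem_orbitClosure.1 hξ (box a₀ R ∪ box a R)
    ((finite_box _ _).union (finite_box _ _))
  have key : ∀ c : ℤ × ℤ, (¬ ∃ n d, OccursIn (box c R) ξ n d) →
      box c R ⊆ box a₀ R ∪ box a R → ∃ t ∈ testDomain, t ∈ box (γ + c) R := by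
    intro c hc hsub
    by_contra! hcon
    obtain ⟨n, d, hd⟩ := exists_occursIn_box h (a := γ + c) (R := R)
      (Set.eq_empty_iff_forall_notMem.2 fun t ht => hcon t ht.2 ht.1)
    rw [← image_add_box] at hd
    exact hc ⟨n, d, hd.shift γ fun x hx => (hγ x (hsub hx)).symm⟩
  obtain ⟨t, ht, ht'⟩ := key a ha Set.subset_union_right
  obtain ⟨s, hs, hs'⟩ := key a₀ h0 Set.subset_union_left
  rw [mem_testDomain] at ht hs
  rw [mem_box] at *
  simp only [Prod.fst_add, Prod.snd_add, Prod.fst_sub, Prod.snd_sub] at *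
  push_cast
  omega

/-! ### The limit subshift -/

/-- The union of finitely many orbit closures. -/
def unionOrbitClosure {k : ℕ} (hk : 1 ≤ k) (ρ : Fin k → Config) : Subshift where
  carrier := ⋃ j, (orbitClosure (ρ j)).carrier
  isClosed := isClosed_iUnion_of_finite fun j => (orbitClosure (ρ j)).isClosed
  nonempty := ⟨ρ ⟨0, hk⟩, Set.mem_iUnion.2 ⟨_, mem_orbitClosure_self _⟩⟩
  invariant := by
    intro γ ω hω
    obtain ⟨j, hj⟩ := Set.mem_iUnion.1 hω
    exact Set.mem_iUnion.2 ⟨j, (orbitClosure (ρ j)).invariant γ ω hj⟩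

theorem translateConfig_mem_orbitClosure (γ : ℤ × ℤ) (ω : Config) :
    (fun x => ω (γ + x)) ∈ (orbitClosure ω).carrier :=
  mem_orbitClosure.2 fun _ _ => ⟨γ, fun _ _ => rfl⟩

theorem convergesTo_unionOrbitClosure (ω₀ : Config) {k : ℕ} (hk : 1 ≤ k) {ρ : Fin k → Config}
    (hρ : Set.range ρ = Set.range fun u : ℤ × ℤ => substLimit fun y => ω₀ (u + y)) :
    Subshift.ConvergesTo (fun n => orbitClosure (subst^[n] ω₀)) (unionOrbitClosure hk ρ) := by
  refine convergesTo_of_patterns fun M hM => ?_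
  filter_upwards [eventually_pattern_in_substLimit ω₀ hM, eventually_pattern_in_iterate ω₀ hM]
    with n h1 h2
  refine ⟨fun ξ hξ => ?_, fun ζ hζ => ?_⟩
  · obtain ⟨γ, hγ⟩ := mem_orbitClosure.1 hξ M hM
    obtain ⟨u, γ', h⟩ := h1 γ
    obtain ⟨j, hj⟩ : substLimit (fun y => ω₀ (u + y)) ∈ Set.range ρ := hρ ▸ ⟨u, rfl⟩
    refine ⟨fun x => ρ j (γ' + x),
      Set.mem_iUnion.2 ⟨j, translateConfig_mem_orbitClosure _ _⟩, fun x hx => ?_⟩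
    rw [hγ x hx, h x hx, hj]
  · obtain ⟨j, hj⟩ := Set.mem_iUnion.1 hζ
    obtain ⟨γ, hγ⟩ := mem_orbitClosure.1 hj M hM
    obtain ⟨u, hu⟩ : ρ j ∈ Set.range fun u : ℤ × ℤ => substLimit fun y => ω₀ (u + y) :=
      hρ ▸ ⟨j, rfl⟩
    obtain ⟨γ', h⟩ := h2 u γ
    refine ⟨_, translateConfig_mem_orbitClosure γ' _, fun x hx => ?_⟩
    rw [hγ x hx, ← hu, ← h x hx]

theorem exists_fin_enumeration {α : Type*} {s : Set α} (hs : s.Finite) (h0 : s.Nonempty) :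
    ∃ (k : ℕ) (ρ : Fin k → α), 1 ≤ k ∧ Set.range ρ = s := by
  have : Finite s := hs
  obtain ⟨k, ⟨e⟩⟩ := Finite.exists_equiv_fin s
  refine ⟨k, fun j => e.symm j, ?_, ?_⟩
  · exact Nat.one_le_iff_ne_zero.2 fun hk => by subst hk; exact (e ⟨_, h0.some_mem⟩).elim0
  · ext x
    exact ⟨by rintro ⟨j, rfl⟩; exact (e.symm j).2, fun hx => ⟨e ⟨x, hx⟩, by simp⟩⟩

/-! ### Spectra and approximate eigenvectors -/

section Hilbert

variable {E : Type*} [NormedAddCommGroup E] [InnerProductSpace ℂ E] [CompleteSpace E]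

/-- Weyl's criterion: the spectrum of a self-adjoint operator consists of the approximate
eigenvalues. -/
theorem mem_realSpectrum_iff {A : E →L[ℂ] E} (hA : IsSelfAdjoint A) {x : ℝ} :
    x ∈ realSpectrum A ↔ ∀ ε > 0, ∃ ψ : E, ψ ≠ 0 ∧ ‖A ψ - (x : ℂ) • ψ‖ < ε * ‖ψ‖ := by
  have hB : IsSelfAdjoint (algebraMap ℂ (E →L[ℂ] E) x - A) := by
    refine IsSelfAdjoint.sub ?_ hA
    rw [Algebra.algebraMap_eq_smul_one]
    exact IsSelfAdjoint.smul (Complex.conj_ofReal x) (.one _)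
  have hBapp : ∀ ψ, ‖(algebraMap ℂ (E →L[ℂ] E) x - A) ψ‖ = ‖A ψ - (x : ℂ) • ψ‖ := fun ψ => by
    rw [norm_sub_rev (A ψ)]; simp [Algebra.algebraMap_eq_smul_one]
  rw [realSpectrum, Set.mem_ofPred_eq, spectrum.mem_iff]
  set B := algebraMap ℂ (E →L[ℂ] E) x - A
  constructor
  · intro h ε hε
    by_contra! hcon
    refine h ?_
    have hlow : ∀ ψ, ε * ‖ψ‖ ≤ ‖B ψ‖ := by
      intro ψ
      rw [hBapp]
      rcases eq_or_ne ψ 0 with rfl | h0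
      · simp
      · exact hcon ψ h0
    -- The lower bound gives injectivity and closed range; self-adjointness turns injectivity into
    -- dense range.
    rw [ContinuousLinearMap.isUnit_iff_bijective,
      ContinuousLinearMap.bijective_iff_dense_range_and_antilipschitz]
    constructor
    · rw [Submodule.topologicalClosure_eq_top_iff, ContinuousLinearMap.orthogonal_range,
        hB.adjoint_eq, eq_bot_iff]
      intro ψ hψ
      have h1 : B ψ = 0 := hψ
      have h2 := hlow ψ
      rw [h1, norm_zero] at h2
      have h3 : ‖ψ‖ = 0 := le_antisymm (by
        by_contra! h3
        have := mul_pos hε h3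
        linarith) (norm_nonneg _)
      exact norm_eq_zero.1 h3
    · refine ⟨⟨ε⁻¹, by positivity⟩, B.antilipschitz_of_bound fun ψ => ?_⟩
      change ‖ψ‖ ≤ ε⁻¹ * ‖B ψ‖
      rw [inv_mul_eq_div, le_div_iff₀ hε, mul_comm]
      exact hlow ψ
  · rintro h ⟨u, hu⟩
    obtain ⟨ψ, h0, hψ⟩ := h (1 / (‖(↑u⁻¹ : E →L[ℂ] E)‖ + 1)) (by positivity)
    rw [← hBapp, ← hu] at hψ
    have h1 : ψ = (↑u⁻¹ : E →L[ℂ] E) ((u : E →L[ℂ] E) ψ) := by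
      rw [← mul_apply_eq_comp, Units.inv_mul, one_apply_eq_self]
    have h2 : ‖ψ‖ ≤ ‖(↑u⁻¹ : E →L[ℂ] E)‖ * ‖(u : E →L[ℂ] E) ψ‖ := by
      conv_lhs => rw [h1]
      exact ContinuousLinearMap.le_opNorm _ _
    rw [one_div, inv_mul_eq_div, lt_div_iff₀ (by positivity)] at hψ
    have := norm_nonneg ((u : E →L[ℂ] E) ψ)
    nlinarith

/-- At an isolated point `x` of the spectrum, `A - x` is bounded below off the eigenspace. -/
theorem exists_norm_le_of_isolated {A : E →L[ℂ] E} (hA : IsSelfAdjoint A) {x : ℝ}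
    (hx : ∃ ε > 0, ∀ z ∈ realSpectrum A, |z - x| < ε → z = x) :
    ∃ C : ℝ, ∀ φ ∈ (Module.End.eigenspace (A : E →ₗ[ℂ] E) (x : ℂ))ᗮ,
      ‖φ‖ ≤ C * ‖A φ - (x : ℂ) • φ‖ := by
  obtain ⟨ε, hε, hx⟩ := hx
  have hspec : ∀ z ∈ spectrum ℝ A, |z - x| < ε → z = x := fun z hz =>
    hx z (by rw [← spectrum.preimage_algebraMap ℂ] at hz; exact hz)
  have hnhds : ∀ z ∈ spectrum ℝ A, ∀ᶠ w in nhdsWithin z (spectrum ℝ A), w = x ∧ z = x ∨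
      w ≠ x ∧ z ≠ x := by
    intro z hz
    rcases eq_or_ne z x with rfl | hzx
    · filter_upwards [self_mem_nhdsWithin, mem_nhdsWithin_of_mem_nhds (Metric.ball_mem_nhds z hε)]
        with w hw hw'
      exact .inl ⟨hspec w hw hw', rfl⟩
    · filter_upwards [mem_nhdsWithin_of_mem_nhds (isOpen_ne.mem_nhds hzx)] with w hw
      exact .inr ⟨hw, hzx⟩
  have hf : ContinuousOn (fun z : ℝ => if z = x then (1 : ℝ) else 0) (spectrum ℝ A) := by
    intro z hz
    refine tendsto_const_nhds.congr' ?_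
    filter_upwards [hnhds z hz] with w hw
    rcases hw with ⟨h1, h2⟩ | ⟨h1, h2⟩ <;> simp [h1, h2]
  -- Since `x` is isolated in the spectrum, the value `0⁻¹ = 0` at `x` does no harm. By functional
  -- calculus this function gives an inverse of `A - x` modulo the spectral projection `p`, which
  -- maps into the eigenspace and vanishes on its orthogonal complement.
  have hg : ContinuousOn (fun z : ℝ => (z - x)⁻¹) (spectrum ℝ A) := by
    intro z hz
    rcases eq_or_ne z x with rfl | hzx
    · refine tendsto_const_nhds.congr' ?_
      filter_upwards [hnhds z hz] with w hw
      rcases hw with ⟨h1, h2⟩ | ⟨h1, h2⟩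
      · simp [h1]
      · exact absurd rfl h2
    · exact ((continuous_id.sub continuous_const).continuousAt.inv₀
        (sub_ne_zero.2 hzx)).continuousWithinAt
  have hd : ContinuousOn (fun z : ℝ => z - x) (spectrum ℝ A) := by fun_prop
  have hAx : cfc (fun z : ℝ => z - x) A = A - algebraMap ℝ (E →L[ℂ] E) x := by
    rw [cfc_sub (fun z : ℝ => z) (fun _ => x) A, cfc_id' ℝ A, cfc_const x A]
  set p := cfc (fun z : ℝ => if z = x then (1 : ℝ) else 0) A with hp
  have h1 : cfc (fun z : ℝ => (z - x)⁻¹) A * (A - algebraMap ℝ (E →L[ℂ] E) x) + p = 1 := by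
    rw [← hAx, ← cfc_mul _ _ A hg hd, hp, ← cfc_add A (fun z => (z - x)⁻¹ * (z - x)) _ (hg.mul hd) hf, ← cfc_one ℝ A]
    refine cfc_congr fun z _ => ?_
    rcases eq_or_ne z x with rfl | hzx
    · simp
    · simp [hzx, inv_mul_cancel₀ (sub_ne_zero.2 hzx)]
  have h2 : (A - algebraMap ℝ (E →L[ℂ] E) x) * p = 0 := by
    rw [← hAx, hp, ← cfc_mul _ _ A hd hf, ← cfc_zero ℝ A]
    refine cfc_congr fun z _ => ?_
    rcases eq_or_ne z x with rfl | hzx <;> simp [*]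
  have hpsa : IsSelfAdjoint p := cfc_predicate _ A
  have happ : ∀ φ, (A - algebraMap ℝ (E →L[ℂ] E) x) φ = A φ - (x : ℂ) • φ := fun φ => by
    simp [Algebra.algebraMap_eq_smul_one]
  have hmem : ∀ φ, p φ ∈ Module.End.eigenspace (A : E →ₗ[ℂ] E) (x : ℂ) := by
    intro φ
    rw [Module.End.mem_eigenspace_iff]
    have h3 := congrArg (fun T : E →L[ℂ] E => T φ) h2
    simp only [mul_apply_eq_comp, happ] at h3
    exact sub_eq_zero.1 h3
  refine ⟨‖cfc (fun z : ℝ => (z - x)⁻¹) A‖, fun φ hφ => ?_⟩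
  have h0 : p φ = 0 := by
    have h3 := (Submodule.mem_orthogonal _ _).1 hφ _ (hmem (p φ))
    rw [← inner_self_eq_zero (𝕜 := ℂ), ← h3]
    exact ((ContinuousLinearMap.isSelfAdjoint_iff_isSymmetric.1 hpsa) (p φ) φ).symm
  have h3 := congrArg (fun T : E →L[ℂ] E => T φ) h1
  simp only [add_apply, mul_apply_eq_comp, h0, add_zero,
    one_apply_eq_self, happ] at h3
  conv_lhs => rw [← h3]
  exact ContinuousLinearMap.le_opNorm _ _

/-- If `A - x` is bounded below off the eigenspace, then `x` is isolated in the spectrum, and an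
eigenvalue if it belongs to the spectrum. -/
theorem isolated_of_norm_le {A : E →L[ℂ] E} (hA : IsSelfAdjoint A) {x c : ℝ} (hc : 0 < c)
    [(Module.End.eigenspace (A : E →ₗ[ℂ] E) (x : ℂ)).HasOrthogonalProjection]
    (h : ∀ φ ∈ (Module.End.eigenspace (A : E →ₗ[ℂ] E) (x : ℂ))ᗮ,
      c * ‖φ‖ ≤ ‖A φ - (x : ℂ) • φ‖) :
    (∃ ε > 0, ∀ z ∈ realSpectrum A, |z - x| < ε → z = x) ∧
      (x ∈ realSpectrum A → Module.End.HasEigenvalue (A : E →ₗ[ℂ] E) (x : ℂ)) := by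
  set V := Module.End.eigenspace (A : E →ₗ[ℂ] E) (x : ℂ) with hV
  have hsymm := ContinuousLinearMap.isSelfAdjoint_iff_isSymmetric.1 hA
  constructor
  · refine ⟨c, hc, fun z hz hzx => ?_⟩
    by_contra hne
    -- `A - z` preserves the orthogonal splitting; it is bounded below by `|z - x|` on the
    -- eigenspace and by `c - |z - x|` on the complement.
    set δ := min |z - x| (c - |z - x|) with hδ
    have hδ0 : 0 < δ := lt_min (abs_pos.2 (sub_ne_zero.2 hne)) (by linarith)
    obtain ⟨ψ, h0, hψ⟩ := (mem_realSpectrum_iff hA).1 hz δ hδ0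
    obtain ⟨v, hv, w, hw, rfl⟩ := V.exists_add_mem_mem_orthogonal ψ
    have hv' : A v = (x : ℂ) • v := Module.End.mem_eigenspace_iff.1 hv
    have horth : ∀ v' ∈ V, inner ℂ v' w = 0 := fun v' hv' =>
      (Submodule.mem_orthogonal _ _).1 hw v' hv'
    have e : A (v + w) - (z : ℂ) • (v + w) = ((x : ℂ) - z) • v + (A w - (z : ℂ) • w) := by
      rw [map_add, hv', smul_add, sub_smul]; abel
    have hAw : inner ℂ v (A w) = 0 := by
      rw [show inner ℂ v (A w) = inner ℂ (A v) w from (hsymm v w).symm, hv', inner_smul_left,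
        horth v hv, mul_zero]
    have ho1 : inner ℂ (((x : ℂ) - z) • v) (A w - (z : ℂ) • w) = 0 := by
      rw [inner_smul_left, inner_sub_right, hAw, inner_smul_right, horth v hv]; simp
    have p1 := norm_add_sq_eq_norm_sq_add_norm_sq_of_inner_eq_zero _ _ ho1
    have p2 := norm_add_sq_eq_norm_sq_add_norm_sq_of_inner_eq_zero _ _ (horth v hv)
    rw [e] at hψ
    have b1 : ‖((x : ℂ) - z) • v‖ = |z - x| * ‖v‖ := by
      rw [norm_smul, ← Complex.ofReal_sub, Complex.norm_real, Real.norm_eq_abs, abs_sub_comm]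
    have b2 : (c - |z - x|) * ‖w‖ ≤ ‖A w - (z : ℂ) • w‖ := by
      have e2 : A w - (x : ℂ) • w = (A w - (z : ℂ) • w) + ((z : ℂ) - x) • w := by
        rw [sub_smul]; abel
      have e3 := h w hw
      rw [e2] at e3
      have e4 := norm_add_le (A w - (z : ℂ) • w) (((z : ℂ) - x) • w)
      have e5 : ‖((z : ℂ) - x) • w‖ = |z - x| * ‖w‖ := by
        rw [norm_smul, ← Complex.ofReal_sub, Complex.norm_real, Real.norm_eq_abs]
      linarith
    have b3 : δ * ‖v‖ ≤ ‖((x : ℂ) - z) • v‖ := by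
      rw [b1]; exact mul_le_mul_of_nonneg_right (min_le_left _ _) (norm_nonneg _)
    have b4 : δ * ‖w‖ ≤ ‖A w - (z : ℂ) • w‖ :=
      (mul_le_mul_of_nonneg_right (min_le_right _ _) (norm_nonneg _)).trans b2
    have b5 := mul_self_le_mul_self (by positivity) b3
    have b6 := mul_self_le_mul_self (by positivity) b4
    have b7 := mul_self_lt_mul_self (norm_nonneg _) hψ
    have : δ * ‖v + w‖ * (δ * ‖v + w‖) = δ * δ * (‖v‖ * ‖v‖ + ‖w‖ * ‖w‖) := by
      rw [← p2]; ring
    linarith [mul_mul_mul_comm δ ‖v‖ δ ‖v‖, mul_mul_mul_comm δ ‖w‖ δ ‖w‖]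
  · intro hx hbot
    change V = ⊥ at hbot
    obtain ⟨ψ, h0, hψ⟩ := (mem_realSpectrum_iff hA).1 hx c hc
    have := h ψ (by rw [hbot, Submodule.bot_orthogonal_eq_top]; trivial)
    linarith

end Hilbert

/-! ### Restrictions of square summable functions -/

theorem norm_weightedShift_le (c : ℤ × ℤ → ℂ) {C : ℝ} (hc : ∀ γ, ‖c γ‖ ≤ C) (η : ℤ × ℤ)
    (ψ : EllTwo) : ‖weightedShift c hc η ψ‖ ≤ C * ‖ψ‖ :=
  ContinuousLinearMap.le_of_opNorm_le _ (LinearMap.mkContinuous_norm_le _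
    ((norm_nonneg _).trans (hc 0)) _) ψ

theorem norm_indicator_one_le (S : Set (ℤ × ℤ)) (γ : ℤ × ℤ) :
    ‖S.indicator (1 : ℤ × ℤ → ℂ) γ‖ ≤ 1 := by
  by_cases h : γ ∈ S <;> simp [h]

/-- Multiplication by the indicator function of `S`. -/
noncomputable def cut (S : Set (ℤ × ℤ)) : EllTwo →L[ℂ] EllTwo :=
  weightedShift (S.indicator 1) (norm_indicator_one_le S) 0

theorem cut_apply (S : Set (ℤ × ℤ)) (ψ : EllTwo) (γ : ℤ × ℤ) :
    cut S ψ γ = S.indicator 1 γ * ψ γ := by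
  change S.indicator 1 γ * ψ (γ + 0) = _
  rw [add_zero]

theorem cut_apply_mem {S : Set (ℤ × ℤ)} {γ : ℤ × ℤ} (h : γ ∈ S) (ψ : EllTwo) :
    cut S ψ γ = ψ γ := by simp [cut_apply, h]

theorem cut_apply_notMem {S : Set (ℤ × ℤ)} {γ : ℤ × ℤ} (h : γ ∉ S) (ψ : EllTwo) :
    cut S ψ γ = 0 := by simp [cut_apply, h]

theorem norm_cut_le (S : Set (ℤ × ℤ)) (ψ : EllTwo) : ‖cut S ψ‖ ≤ ‖ψ‖ :=
  (norm_weightedShift_le _ (norm_indicator_one_le S) 0 ψ).trans_eq (one_mul _)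

theorem cut_add_cut_compl (S : Set (ℤ × ℤ)) (ψ : EllTwo) : cut S ψ + cut Sᶜ ψ = ψ := by
  ext γ
  change cut S ψ γ + cut Sᶜ ψ γ = ψ γ
  by_cases h : γ ∈ S
  · rw [cut_apply_mem h, cut_apply_notMem (by simpa using h), add_zero]
  · rw [cut_apply_notMem h, cut_apply_mem (by simpa using h), zero_add]

theorem exists_norm_cut_compl_lt (ψ : EllTwo) {ε : ℝ} (hε : 0 < ε) :
    ∃ K : Finset (ℤ × ℤ), ∀ K', K ⊆ K' → ‖cut (K' : Set (ℤ × ℤ))ᶜ ψ‖ < ε := by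
  have h := lp.hasSum_single (p := 2) (by norm_num) ψ
  obtain ⟨K, hK⟩ := Filter.eventually_atTop.1
    (Metric.tendsto_nhds.1 (show Filter.Tendsto _ _ _ from h) ε hε)
  refine ⟨K, fun K' hKK' => ?_⟩
  have h1 := hK K' hKK'
  rw [dist_comm, dist_eq_norm] at h1
  refine lt_of_le_of_lt ?_ h1
  refine le_trans (le_of_eq ?_) (norm_cut_le (K' : Set (ℤ × ℤ))ᶜ _)
  congr 1
  rw [map_sub, eq_comm, sub_eq_self, map_sum]
  refine Finset.sum_eq_zero fun i hi => ?_
  ext γ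
  change cut _ _ γ = 0
  by_cases h2 : γ ∈ K'
  · exact cut_apply_notMem (by simpa using h2) _
  · rw [cut_apply_mem (by simpa using h2), lp.single_apply_ne]
    rintro rfl
    exact h2 hi

theorem inner_eq_inner_cut {K : Set (ℤ × ℤ)} {ψ : EllTwo} (hψ : ∀ γ ∈ K, ψ γ = 0) (φ : EllTwo) :
    inner ℂ φ ψ = inner ℂ (cut Kᶜ φ) ψ := by
  rw [lp.inner_eq_tsum, lp.inner_eq_tsum]
  congr 1; ext γ
  by_cases h : γ ∈ K
  · rw [hψ γ h, inner_zero_right, inner_zero_right]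
  · rw [cut_apply_mem (by simpa using h)]

/-- Functions in a finite-dimensional subspace are uniformly small off a finite set. -/
theorem exists_finset_forall_norm_cut_compl_le (V : Submodule ℂ EllTwo) [FiniteDimensional ℂ V]
    {ε : ℝ} (hε : 0 < ε) :
    ∃ K : Finset (ℤ × ℤ), ∀ v ∈ V, ‖cut (K : Set (ℤ × ℤ))ᶜ v‖ ≤ ε * ‖v‖ := by
  set d := Module.finrank ℂ V with hd
  let e := stdOrthonormalBasis ℂ V
  choose K hK using fun i => exists_norm_cut_compl_lt (e i : EllTwo)
    (show 0 < ε / (d + 1) by positivity)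
  classical
  refine ⟨Finset.univ.biUnion K, fun v hv => ?_⟩
  have hv' : v = ∑ i, inner ℂ (e i) (⟨v, hv⟩ : V) • (e i : EllTwo) := by
    have := congrArg (fun u : V => (u : EllTwo)) (e.sum_repr' ⟨v, hv⟩)
    simpa using this.symm
  conv_lhs => rw [hv']
  rw [map_sum]
  calc _ ≤ ∑ i : Fin d, ‖v‖ * (ε / (d + 1)) := norm_sum_le_of_le _ fun i _ => by
        rw [map_smul, norm_smul]
        refine mul_le_mul ?_ (hK i _ (Finset.subset_biUnion_of_mem K (Finset.mem_univ i))).le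
          (norm_nonneg _) (norm_nonneg _)
        refine (norm_inner_le_norm (𝕜 := ℂ) (e i) (⟨v, hv⟩ : V)).trans ?_
        rw [e.norm_eq_one, one_mul, Submodule.coe_norm]
    _ = d / (d + 1) * (ε * ‖v‖) := by
        rw [Finset.sum_const, Finset.card_univ, Fintype.card_fin, nsmul_eq_mul]; ring
    _ ≤ 1 * (ε * ‖v‖) := by
        gcongr
        rw [div_le_one (by positivity)]; linarith
    _ = ε * ‖v‖ := one_mul _

theorem norm_cut_le_sum (K : Finset (ℤ × ℤ)) (ψ : EllTwo) :
    ‖cut (K : Set (ℤ × ℤ)) ψ‖ ≤ ∑ γ ∈ K, ‖ψ γ‖ := by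
  have h : cut (K : Set (ℤ × ℤ)) ψ = ∑ γ ∈ K, lp.single 2 γ (ψ γ) := by
    ext δ
    rw [lp.coeFn_sum, Finset.sum_apply]
    by_cases hδ : δ ∈ K
    · rw [cut_apply_mem (by simpa using hδ), Finset.sum_eq_single_of_mem δ hδ]
      · simp
      · intro γ _ hne
        exact lp.single_apply_ne _ _ _ hne.symm
    · rw [cut_apply_notMem (by simpa using hδ), Finset.sum_eq_zero]
      intro γ hγ
      exact lp.single_apply_ne _ _ _ (by rintro rfl; exact hδ hγ)
  rw [h]
  refine (norm_sum_le _ _).trans (Finset.sum_le_sum fun γ _ => ?_)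
  rw [lp.norm_single (by norm_num)]

/-! ### The essential spectrum -/

/-- If `A - x` is bounded below on the functions that vanish on a finite set, then its kernel is
finite-dimensional. -/
theorem finiteDimensional_eigenspace {A : EllTwo →L[ℂ] EllTwo} {x ε : ℝ} (hε : 0 < ε)
    {K : Finset (ℤ × ℤ)}
    (h : ∀ ψ : EllTwo, (∀ γ ∈ K, ψ γ = 0) → ε * ‖ψ‖ ≤ ‖A ψ - (x : ℂ) • ψ‖) :
    FiniteDimensional ℂ (Module.End.eigenspace (A : EllTwo →ₗ[ℂ] EllTwo) (x : ℂ)) := by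
  let f : Module.End.eigenspace (A : EllTwo →ₗ[ℂ] EllTwo) (x : ℂ) →ₗ[ℂ] (K → ℂ) :=
    { toFun := fun ψ γ => (ψ : EllTwo) γ
      map_add' := fun _ _ => rfl
      map_smul' := fun _ _ => rfl }
  refine FiniteDimensional.of_injective f ((injective_iff_map_eq_zero f).2 fun ψ hψ => ?_)
  have h1 := h ψ fun γ hγ => congrFun hψ ⟨γ, hγ⟩
  have h2 : A ψ = (x : ℂ) • (ψ : EllTwo) := Module.End.mem_eigenspace_iff.1 ψ.2
  rw [h2, sub_self, norm_zero] at h1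
  have h3 : ‖(ψ : EllTwo)‖ = 0 := le_antisymm (by
    by_contra! h3
    have := mul_pos hε h3
    linarith) (norm_nonneg _)
  exact Subtype.ext (norm_eq_zero.1 h3)

/-- If `A - x` is bounded below on the functions that vanish on a finite set, then it is bounded
below off its kernel. -/
theorem exists_le_norm_of_orthogonal {A : EllTwo →L[ℂ] EllTwo} {x ε : ℝ} (hε : 0 < ε)
    {K : Finset (ℤ × ℤ)}
    (h : ∀ ψ : EllTwo, (∀ γ ∈ K, ψ γ = 0) → ε * ‖ψ‖ ≤ ‖A ψ - (x : ℂ) • ψ‖) :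
    ∃ c > 0, ∀ φ ∈ (Module.End.eigenspace (A : EllTwo →ₗ[ℂ] EllTwo) (x : ℂ))ᗮ,
      c * ‖φ‖ ≤ ‖A φ - (x : ℂ) • φ‖ := by
  set V := Module.End.eigenspace (A : EllTwo →ₗ[ℂ] EllTwo) (x : ℂ) with hV
  set B : EllTwo →L[ℂ] EllTwo := A - (x : ℂ) • ContinuousLinearMap.id ℂ EllTwo with hB
  have hBapp : ∀ ψ, B ψ = A ψ - (x : ℂ) • ψ := fun ψ => rfl
  simp only [← hBapp] at *
  have hbound : ∀ ψ, ε * ‖ψ‖ ≤ ‖B ψ‖ + (‖B‖ + ε) * ∑ γ ∈ K, ‖ψ γ‖ := by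
    intro ψ
    have h1 := h (cut (K : Set (ℤ × ℤ))ᶜ ψ) fun γ hγ => cut_apply_notMem (by simpa using hγ) _
    have h2 := cut_add_cut_compl (K : Set (ℤ × ℤ)) ψ
    have h3 := norm_cut_le_sum K ψ
    have h4 : B (cut (K : Set (ℤ × ℤ))ᶜ ψ) = B ψ - B (cut (K : Set (ℤ × ℤ)) ψ) := by
      rw [← map_sub, eq_sub_of_add_eq' h2]
    have h5 := B.le_opNorm (cut (K : Set (ℤ × ℤ)) ψ)
    have h6 := norm_sub_le (B ψ) (B (cut (K : Set (ℤ × ℤ)) ψ))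
    have h7 := norm_add_le (cut (K : Set (ℤ × ℤ)) ψ) (cut (K : Set (ℤ × ℤ))ᶜ ψ)
    rw [h2] at h7
    rw [h4] at h1
    have h8 : (‖B‖ + ε) * ‖cut (K : Set (ℤ × ℤ)) ψ‖ ≤ (‖B‖ + ε) * ∑ γ ∈ K, ‖ψ γ‖ := by gcongr
    have h9 := mul_le_mul_of_nonneg_left h7 hε.le
    linarith
  -- Otherwise there are unit vectors orthogonal to the kernel with `B φ → 0`. Their values on `K`
  -- converge along a subsequence, `hbound` makes it Cauchy, and the limit is a unit vector both in
  -- the kernel and orthogonal to it.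
  by_contra! hcon
  have hseq : ∀ n : ℕ, ∃ φ ∈ Vᗮ, ‖φ‖ = 1 ∧ ‖B φ‖ < 1 / ((n : ℝ) + 1) := by
    intro n
    obtain ⟨φ, hφ, hlt⟩ := hcon (1 / ((n : ℝ) + 1)) (by positivity)
    have h0 : 0 < ‖φ‖ := by
      rcases eq_or_ne φ 0 with rfl | h0
      · simp at hlt
      · exact norm_pos_iff.2 h0
    refine ⟨((‖φ‖⁻¹ : ℝ) : ℂ) • φ, Vᗮ.smul_mem _ hφ, ?_, ?_⟩
    · rw [norm_smul, Complex.norm_real, norm_inv, norm_norm, inv_mul_cancel₀ h0.ne']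
    · rw [map_smul, norm_smul, Complex.norm_real, norm_inv, norm_norm, inv_mul_lt_iff₀ h0,
        mul_comm]
      exact hlt
  choose φ hφV hφ1 hφB using hseq
  have hr : ∀ n, (fun γ : K => φ n γ) ∈ Metric.closedBall (0 : K → ℂ) 1 := by
    intro n
    rw [mem_closedBall_zero_iff, pi_norm_le_iff_of_nonneg zero_le_one]
    exact fun γ => (lp.norm_apply_le_norm (by norm_num) (φ n) γ).trans (hφ1 n).le
  obtain ⟨a, -, s, hs, ha⟩ := (isCompact_closedBall (0 : K → ℂ) 1).tendsto_subseq hr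
  have hB0 : Filter.Tendsto (fun n => ‖B (φ (s n))‖) Filter.atTop (nhds 0) :=
    (squeeze_zero (fun n => norm_nonneg _) (fun n => (hφB n).le)
      tendsto_one_div_add_atTop_nhds_zero_nat).comp hs.tendsto_atTop
  have hcauchy : CauchySeq (fun n => φ (s n)) := by
    rw [Metric.cauchySeq_iff']
    intro δ hδ
    set D := (‖B‖ + ε) * (K.card : ℝ) with hD
    have hD0 : 0 ≤ D := by positivity
    obtain ⟨N1, hN1⟩ := Filter.eventually_atTop.1
      (hB0.eventually (gt_mem_nhds (show 0 < ε * δ / 4 by positivity)))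
    obtain ⟨N3, hN3⟩ := Metric.cauchySeq_iff.1 ha.cauchySeq (ε * δ / (4 * (D + 1)))
      (by positivity)
    refine ⟨max N1 N3, fun n hn => ?_⟩
    have h1 := hN1 n (le_of_max_le_left hn)
    have h2 := hN1 (max N1 N3) (le_max_left _ _)
    have h3 := hN3 n (le_of_max_le_right hn) (max N1 N3) (le_max_right _ _)
    have h4 := hbound (φ (s n) - φ (s (max N1 N3)))
    have h5 : ∑ γ ∈ K, ‖(φ (s n) - φ (s (max N1 N3))) γ‖ ≤
        K.card * (ε * δ / (4 * (D + 1))) := by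
      rw [← nsmul_eq_mul]
      refine Finset.sum_le_card_nsmul _ _ _ fun γ hγ => ?_
      refine le_trans ?_ h3.le
      rw [dist_eq_norm]
      exact norm_le_pi_norm ((fun γ : K => φ (s n) γ) - fun γ : K => φ (s (max N1 N3)) γ) ⟨γ, hγ⟩
    have h6 := norm_sub_le (B (φ (s n))) (B (φ (s (max N1 N3))))
    rw [← map_sub] at h6
    have h7 : (‖B‖ + ε) * ∑ γ ∈ K, ‖(φ (s n) - φ (s (max N1 N3))) γ‖ ≤ ε * δ / 4 := by
      calc _ ≤ (‖B‖ + ε) * (K.card * (ε * δ / (4 * (D + 1)))) := by gcongr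
        _ = D / (D + 1) * (ε * δ / 4) := by rw [hD]; field_simp
        _ ≤ 1 * (ε * δ / 4) := by
          gcongr
          rw [div_le_one (by positivity)]; linarith
        _ = ε * δ / 4 := one_mul _
    rw [dist_eq_norm]
    have h8 : ε * ‖φ (s n) - φ (s (max N1 N3))‖ < ε * δ := by
      have : 0 < ε * δ := by positivity
      linarith
    exact lt_of_mul_lt_mul_left h8 hε.le
  obtain ⟨ψ, hψ⟩ := cauchySeq_tendsto_of_complete hcauchy
  have h1 : ‖ψ‖ = 1 := tendsto_nhds_unique hψ.norm (by simp [hφ1])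
  have h2 : B ψ = 0 := norm_eq_zero.1 (tendsto_nhds_unique ((B.continuous.tendsto ψ).comp hψ).norm
    hB0)
  have h3 : ψ ∈ Vᗮ := V.isClosed_orthogonal.mem_of_tendsto hψ
    (Filter.Eventually.of_forall fun n => hφV _)
  have h4 : ψ ∈ V := Module.End.mem_eigenspace_iff.2 (sub_eq_zero.1 h2)
  have h5 : ψ = 0 := by
    rw [← inner_self_eq_zero (𝕜 := ℂ)]
    exact (Submodule.mem_orthogonal _ _).1 h3 _ h4
  rw [h5, norm_zero] at h1
  exact zero_ne_one h1

/-- The essential spectrum consists of the approximate eigenvalues with approximate eigenvectors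
off every finite set. -/
theorem mem_essSpectrum_iff {A : EllTwo →L[ℂ] EllTwo} (hA : IsSelfAdjoint A) {x : ℝ} :
    x ∈ essSpectrum A ↔ ∀ ε > 0, ∀ K : Finset (ℤ × ℤ), ∃ ψ : EllTwo, ψ ≠ 0 ∧
      (∀ γ ∈ K, ψ γ = 0) ∧ ‖A ψ - (x : ℂ) • ψ‖ < ε * ‖ψ‖ := by
  constructor
  · rintro ⟨hx, hnd⟩ ε hε K
    by_contra! hcon
    have h : ∀ ψ : EllTwo, (∀ γ ∈ K, ψ γ = 0) → ε * ‖ψ‖ ≤ ‖A ψ - (x : ℂ) • ψ‖ := by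
      intro ψ hψ
      rcases eq_or_ne ψ 0 with rfl | h0
      · simp
      · exact hcon ψ h0 hψ
    have hfin := finiteDimensional_eigenspace hε h
    obtain ⟨c, hc, hlow⟩ := exists_le_norm_of_orthogonal hε h
    obtain ⟨h1, h2⟩ := isolated_of_norm_le hA hc hlow
    exact hnd ⟨hx, h1, h2 hx, hfin⟩
  · intro h
    refine ⟨(mem_realSpectrum_iff hA).2 fun ε hε => ?_, ?_⟩
    · obtain ⟨ψ, h0, -, h1⟩ := h ε hε ∅
      exact ⟨ψ, h0, h1⟩
    · rintro ⟨-, hiso, -, hfin⟩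
      obtain ⟨C, hC⟩ := exists_norm_le_of_isolated hA hiso
      set V := Module.End.eigenspace (A : EllTwo →ₗ[ℂ] EllTwo) (x : ℂ) with hV
      obtain ⟨K, hK⟩ := exists_finset_forall_norm_cut_compl_le V one_half_pos
      obtain ⟨ψ, h0, hψ, hlt⟩ := h (1 / (2 * (|C| + 1))) (by positivity) K
      obtain ⟨v, hv, w, hw, hvw⟩ := V.exists_add_mem_mem_orthogonal ψ
      -- As `ψ` vanishes on `K`, it only sees the part of `v` off `K`, which is small. So `ψ` has at
      -- least half its norm orthogonal to the eigenspace, against the bound `hC`.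
      have h1 : ‖v‖ * ‖v‖ ≤ 1 / 2 * ‖v‖ * ‖ψ‖ := by
        have e1 : inner ℂ v ψ = inner ℂ v v := by
          rw [hvw, inner_add_right, (Submodule.mem_orthogonal _ _).1 hw v hv, add_zero]
        have e2 := norm_inner_le_norm (𝕜 := ℂ) (cut (K : Set (ℤ × ℤ))ᶜ v) ψ
        rw [← inner_eq_inner_cut (by simpa using hψ), e1, inner_self_eq_norm_sq_to_K, norm_pow,
          RCLike.norm_ofReal, abs_norm, sq] at e2
        exact e2.trans (mul_le_mul_of_nonneg_right (hK v hv) (norm_nonneg _))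
      have h2 : ‖v‖ ≤ 1 / 2 * ‖ψ‖ := by
        rcases (norm_nonneg v).eq_or_lt with h3 | h3
        · rw [← h3]; positivity
        · nlinarith
      have h3 : A ψ - (x : ℂ) • ψ = A w - (x : ℂ) • w := by
        have : A v = (x : ℂ) • v := Module.End.mem_eigenspace_iff.1 hv
        rw [hvw, map_add, smul_add, this]; abel
      have h4 := hC w hw
      rw [← h3] at h4
      have h5 : ‖ψ‖ ≤ ‖v‖ + ‖w‖ := hvw ▸ norm_add_le v w
      have h6 : 0 < ‖ψ‖ := norm_pos_iff.2 h0
      have h7 : C * ‖A ψ - (x : ℂ) • ψ‖ ≤ (|C| + 1) * ‖A ψ - (x : ℂ) • ψ‖ := by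
        gcongr
        linarith [le_abs_self C]
      have h8 : (|C| + 1) * ‖A ψ - (x : ℂ) • ψ‖ < 1 / 2 * ‖ψ‖ := by
        calc _ < (|C| + 1) * (1 / (2 * (|C| + 1)) * ‖ψ‖) := by gcongr
          _ = 1 / 2 * ‖ψ‖ := by field_simp
      linarith

/-- A set of isolated points of a subset of `ℝ` is discrete and Lindelöf, hence countable. -/
theorem countable_discreteSpectrum {E : Type*} [NormedAddCommGroup E] [NormedSpace ℂ E]
    (A : E →L[ℂ] E) : (discreteSpectrum A).Countable := by
  have : DiscreteTopology (discreteSpectrum A) := by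
    rw [discreteTopology_iff_isOpen_singleton]
    rintro ⟨x, hx⟩
    obtain ⟨-, ⟨ε, hε, h⟩, -⟩ := id hx
    rw [Metric.isOpen_iff]
    rintro _ rfl
    exact ⟨ε, hε, fun z hz => Subtype.ext (h z z.2.1 hz)⟩
  exact Set.countable_coe_iff.1 countable_of_Lindelof_of_discrete

/-! ### Localization of approximate eigenvectors -/

theorem hasSum_norm_sq (ψ : EllTwo) : HasSum (fun γ => ‖ψ γ‖ ^ 2) (‖ψ‖ ^ 2) := by
  simpa using lp.hasSum_norm (p := 2) (by norm_num) ψ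

theorem norm_cut_image_sq (S : Finset (ℤ × ℤ)) (a : ℤ × ℤ) (ψ : EllTwo) :
    ‖cut ((a + ·) '' (S : Set (ℤ × ℤ))) ψ‖ ^ 2 = ∑ s ∈ S, ‖ψ (a + s)‖ ^ 2 := by
  rw [← (hasSum_norm_sq _).tsum_eq, tsum_eq_sum (s := S.image (a + ·)),
    Finset.sum_image fun _ _ _ _ h => add_left_cancel h]
  · exact Finset.sum_congr rfl fun s hs => by
      rw [cut_apply_mem (Set.mem_image_of_mem _ hs)]
  · intro γ hγ
    rw [cut_apply_notMem (by simpa using hγ), norm_zero, zero_pow two_ne_zero]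

/-- Every point belongs to as many translates of `S` as `S` has elements. -/
theorem hasSum_norm_cut_image_sq (S : Finset (ℤ × ℤ)) (ψ : EllTwo) :
    HasSum (fun a => ‖cut ((a + ·) '' (S : Set (ℤ × ℤ))) ψ‖ ^ 2) (S.card * ‖ψ‖ ^ 2) := by
  simp only [norm_cut_image_sq]
  rw [← nsmul_eq_mul, ← Finset.sum_const]
  exact hasSum_sum fun s _ => (Equiv.addRight s).hasSum_iff.2 (hasSum_norm_sq ψ)

/-- The square `[a, R)²` as a finite set. -/
noncomputable def square (a R : ℤ) : Finset (ℤ × ℤ) := Finset.Ico a R ×ˢ Finset.Ico a R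

theorem mem_square {a R : ℤ} {x : ℤ × ℤ} :
    x ∈ square a R ↔ (a ≤ x.1 ∧ x.1 < R) ∧ (a ≤ x.2 ∧ x.2 < R) := by
  simp [square]

theorem card_square (a R : ℤ) (h : a ≤ R) : ((square a R).card : ℝ) = (R - a) ^ 2 := by
  rw [square, Finset.card_product, Int.card_Ico]
  have : (((R - a).toNat : ℤ) : ℝ) = R - a := by rw [Int.toNat_of_nonneg (by omega)]; simp
  rw [Nat.cast_mul, sq, ← this, Int.cast_natCast]

theorem image_square (a : ℤ × ℤ) (R : ℕ) : (a + ·) '' (square 0 R : Set (ℤ × ℤ)) = box a R := by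
  have : (square 0 R : Set (ℤ × ℤ)) = box 0 R := by
    ext x; rw [Finset.mem_coe, mem_square, mem_box]; simp
  rw [this, image_add_box, add_zero]

/-- The boundary layer of width `h` of the square `[0, R)²`. -/
noncomputable def boundaryLayer (h R : ℕ) : Finset (ℤ × ℤ) := square (-h) (R + h) \ square h (R - h)

theorem card_boundaryLayer {h R : ℕ} (hR : 2 * h ≤ R) :
    ((boundaryLayer h R).card : ℝ) = 8 * h * R := by
  have hsub : square (h : ℤ) (R - h) ⊆ square (-h) (R + h) := by
    intro x hx
    rw [mem_square] at *
    omega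
  have h1 := Finset.card_sdiff_add_card_eq_card hsub
  have h2 := card_square (-h : ℤ) (R + h) (by omega)
  have h3 := card_square (h : ℤ) (R - h) (by omega)
  rw [← h1] at h2
  push_cast at h2 h3
  rw [h3] at h2
  rw [boundaryLayer]
  linarith

/-- Cutting off to a square almost commutes with operators of finite range. -/
theorem norm_weightedShift_commutator_le (c : ℤ × ℤ → ℂ) {C : ℝ} (hc : ∀ γ, ‖c γ‖ ≤ C)
    {η : ℤ × ℤ} {h : ℕ} (h1 : η.1.natAbs ≤ h) (h2 : η.2.natAbs ≤ h) (a : ℤ × ℤ) (R : ℕ)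
    (ψ : EllTwo) :
    ‖weightedShift c hc η (cut (box a R) ψ) - cut (box a R) (weightedShift c hc η ψ)‖ ≤
      C * ‖cut ((a + ·) '' (boundaryLayer h R : Set (ℤ × ℤ))) ψ‖ := by
  set D : Set (ℤ × ℤ) := (a + ·) '' (boundaryLayer h R : Set (ℤ × ℤ)) with hD
  -- The commutator is again a weighted shift. Its weight vanishes unless the shift by `η` crosses
  -- the boundary of the square, which puts `γ + η` into the boundary layer.
  set d : ℤ × ℤ → ℂ := fun γ =>
    c γ * ((box a R).indicator 1 (γ + η) - (box a R).indicator 1 γ) with hd_def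
  have hd : ∀ γ, ‖d γ‖ ≤ C := by
    intro γ
    have h3 := hc γ
    have h4 := (norm_nonneg _).trans h3
    by_cases e1 : γ + η ∈ box a R <;> by_cases e2 : γ ∈ box a R <;> simp [d, e1, e2, h3, h4]
  have key : weightedShift c hc η (cut (box a R) ψ) - cut (box a R) (weightedShift c hc η ψ) =
      weightedShift d hd η (cut D ψ) := by
    ext γ
    change c γ * cut (box a R) ψ (γ + η) - cut (box a R) (weightedShift c hc η ψ) γ =
      d γ * cut D ψ (γ + η)
    rw [cut_apply, cut_apply, show weightedShift c hc η ψ γ = c γ * ψ (γ + η) from rfl]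
    by_cases hγ : γ + η ∈ D
    · rw [cut_apply_mem hγ, hd_def]; ring
    · rw [cut_apply_notMem hγ]
      have : (γ + η ∈ box a R) ↔ γ ∈ box a R := by
        by_contra hne
        refine hγ ⟨γ + η - a, ?_, by simp⟩
        rw [Finset.mem_coe, boundaryLayer, Finset.mem_sdiff, mem_square, mem_square]
        rw [mem_box, mem_box] at hne
        simp only [Prod.fst_add, Prod.snd_add, Prod.fst_sub, Prod.snd_sub] at *
        omega
      by_cases e2 : γ ∈ box a R
      · simp [e2, this.2 e2]
      · simp [e2, mt this.1 e2]
  rw [key]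
  exact norm_weightedShift_le _ _ _ _

/-- An approximate eigenvector of an operator of finite range can be cut off to a square of a
size that only depends on the error. -/
theorem SchrodingerOperator.exists_localization (H : SchrodingerOperator) {δ : ℝ} (hδ : 0 < δ) :
    ∃ R : ℕ, ∃ ε > 0, ∀ (ω : Config) (x : ℝ) (ψ : EllTwo),
      ‖H.op ω ψ - (x : ℂ) • ψ‖ < ε * ‖ψ‖ →
      ∃ a : ℤ × ℤ, ‖H.op ω (cut (box a R) ψ) - (x : ℂ) • cut (box a R) ψ‖ <
        δ * ‖cut (box a R) ψ‖ := by
  obtain ⟨h, hh⟩ : ∃ h : ℕ, ∀ η ∈ H.range, η.1.natAbs ≤ h ∧ η.2.natAbs ≤ h := by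
    obtain ⟨h, hh⟩ := exists_subset_box H.range.finite_toSet
    refine ⟨h, fun η hη => ?_⟩
    have := mem_box.1 (hh hη)
    simp only at this
    omega
  set C : ℝ := ∑ η ∈ H.range, ‖H.t η‖ with hC
  have hC0 : 0 ≤ C := Finset.sum_nonneg fun _ _ => norm_nonneg _
  -- With this `R`, the boundary term `2 * C ^ 2 * (8 * h * R)` is at most a quarter of `δ ^ 2 * R ^
  -- 2`. The error `δ / 2` contributes less than a half, so the total stays below the whole.
  obtain ⟨R, hR⟩ := exists_nat_ge (max (64 * C ^ 2 * h / δ ^ 2) (2 * h + 1 : ℝ))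
  have hR1 : 64 * C ^ 2 * h ≤ R * δ ^ 2 := by
    rw [← div_le_iff₀ (by positivity)]; exact (le_max_left _ _).trans hR
  have hR2 : (2 * h + 1 : ℝ) ≤ R := (le_max_right _ _).trans hR
  have hR3 : 2 * h ≤ R := by
    have : 2 * h + 1 ≤ R := by exact_mod_cast hR2
    omega
  have hR0 : (0 : ℝ) < R := by have : (0 : ℝ) ≤ h := by positivity
                               linarith
  refine ⟨R, δ / 2, by positivity, fun ω x ψ hψ => ?_⟩
  set φ := H.op ω ψ - (x : ℂ) • ψ with hφ
  by_contra! hcon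
  have hbound : ∀ a, ‖H.op ω (cut (box a R) ψ) - (x : ℂ) • cut (box a R) ψ‖ ≤
      ‖cut (box a R) φ‖ + C * ‖cut ((a + ·) '' (boundaryLayer h R : Set (ℤ × ℤ))) ψ‖ := by
    intro a
    have e : H.op ω (cut (box a R) ψ) - (x : ℂ) • cut (box a R) ψ = cut (box a R) φ +
        ∑ η ∈ H.range, (weightedShift (fun γ => H.t η (translateConfig (-γ) ω))
            (fun γ => (H.t η).norm_coe_le_norm (translateConfig (-γ) ω)) η (cut (box a R) ψ) -
          cut (box a R) (weightedShift (fun γ => H.t η (translateConfig (-γ) ω))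
            (fun γ => (H.t η).norm_coe_le_norm (translateConfig (-γ) ω)) η ψ)) := by
      rw [hφ, Finset.sum_sub_distrib, ← map_sum, map_sub, map_smul]
      simp only [SchrodingerOperator.op, sum_apply]
      abel
    rw [e]
    refine (norm_add_le _ _).trans (add_le_add le_rfl ?_)
    rw [hC, Finset.sum_mul]
    exact norm_sum_le_of_le _ fun η hη =>
      norm_weightedShift_commutator_le _ _ (hh η hη).1 (hh η hη).2 a R ψ
  have hsum1 := (hasSum_norm_cut_image_sq (square 0 R) ψ).mul_left (δ ^ 2)
  have hsum2 := ((hasSum_norm_cut_image_sq (square 0 R) φ).mul_left 2).add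
    ((hasSum_norm_cut_image_sq (boundaryLayer h R) ψ).mul_left (2 * C ^ 2))
  -- If every square failed, the squared inequalities, bounded by `(p + q)² ≤ 2 p² + 2 q²`, could be
  -- summed over all `a`. Each square norm is then counted `R ^ 2` times, the boundary norm only `8
  -- * h * R` times.
  have hle := hasSum_le (fun a => by
    rw [image_square]
    have h1 := (hcon a).trans (hbound a)
    have h2 := pow_le_pow_left₀ (by positivity) h1 2
    have h3 := sq_nonneg (‖cut (box a R) φ‖ -
      C * ‖cut ((a + ·) '' (boundaryLayer h R : Set (ℤ × ℤ))) ψ‖)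
    nlinarith) hsum1 hsum2
  have hcard := card_square 0 R (by omega)
  rw [hcard, card_boundaryLayer hR3] at hle
  push_cast at hle
  rw [sub_zero] at hle
  have hψ0 : 0 < ‖ψ‖ := by
    by_contra! h0
    have := norm_nonneg φ
    nlinarith
  have h1 : ‖φ‖ ^ 2 < (δ / 2 * ‖ψ‖) ^ 2 := pow_lt_pow_left₀ hψ (norm_nonneg _) two_ne_zero
  have h2 : 64 * C ^ 2 * h * (R * ‖ψ‖ ^ 2) ≤ R * δ ^ 2 * (R * ‖ψ‖ ^ 2) := by gcongr
  have h3 : (R : ℝ) ^ 2 * ‖φ‖ ^ 2 < (R : ℝ) ^ 2 * (δ / 2 * ‖ψ‖) ^ 2 := by gcongr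
  have h4 : 0 < (R : ℝ) ^ 2 * (δ * ‖ψ‖) ^ 2 := by positivity
  nlinarith

/-! ### Transplantation of approximate eigenvectors -/

theorem norm_shift (γ : ℤ × ℤ) (φ : EllTwo) :
    ‖weightedShift (fun _ => 1) (fun _ => norm_one.le) (-γ) φ‖ = ‖φ‖ := by
  refine le_antisymm ((norm_weightedShift_le _ _ _ _).trans_eq (one_mul _)) ?_
  have h : weightedShift (fun _ => 1) (fun _ => norm_one.le) γ
      (weightedShift (fun _ => 1) (fun _ => norm_one.le) (-γ) φ) = φ := by
    ext δ
    change (1 : ℂ) * (1 * φ (δ + γ + -γ)) = φ δ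
    rw [one_mul, one_mul, add_neg_cancel_right]
  conv_lhs => rw [← h]
  exact (norm_weightedShift_le _ _ _ _).trans_eq (one_mul _)

/-- The coefficients depend on a finite part of the configuration, up to a small error. -/
theorem SchrodingerOperator.exists_window (H : SchrodingerOperator) {δ : ℝ} (hδ : 0 < δ) :
    ∃ M : Set (ℤ × ℤ), M.Finite ∧ ∀ ω ω' : Config, (∀ x ∈ M, ω x = ω' x) →
      ∀ η ∈ H.range, ‖H.t η ω - H.t η ω'‖ ≤ δ := by
  refine exists_finite_of_forall_nhds
    (r := fun ω ω' => ∀ η ∈ H.range, ‖H.t η ω - H.t η ω'‖ ≤ δ) fun ω => ?_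
  refine ⟨⋂ η ∈ H.range, H.t η ⁻¹' Metric.ball (H.t η ω) (δ / 2), ?_, ?_⟩
  · exact (Filter.biInter_finset_mem _).2 fun η _ =>
      (H.t η).continuous.continuousAt (Metric.ball_mem_nhds _ (by positivity))
  · intro ω' h' ω'' h'' η hη
    have e1 := Set.mem_iInter₂.1 h' η hη
    have e2 := Set.mem_iInter₂.1 h'' η hη
    rw [Set.mem_preimage, Metric.mem_ball] at e1 e2
    rw [← dist_eq_norm]
    have := dist_triangle_right (H.t η ω') (H.t η ω'') (H.t η ω)
    linarith

theorem SchrodingerOperator.exists_transplantation (H : SchrodingerOperator) {δ : ℝ}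
    (hδ : 0 < δ) :
    ∃ L : ℕ, ∀ (ξ ω : Config) (a γ₀ : ℤ × ℤ) (R : ℕ) (φ : EllTwo),
      (∀ y ∈ box (a - ((L : ℤ), (L : ℤ))) (R + 2 * L + 1), ω (γ₀ + y) = ξ y) →
      (∀ γ, γ ∉ box a R → φ γ = 0) →
      ∃ φ' : EllTwo, ‖φ'‖ = ‖φ‖ ∧ (∀ γ, φ' γ = φ (γ - γ₀)) ∧
        ∀ x : ℝ, ‖H.op ω φ' - (x : ℂ) • φ'‖ ≤ ‖H.op ξ φ - (x : ℂ) • φ‖ + δ * ‖φ‖ := by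
  obtain ⟨M, hM, hMH⟩ := H.exists_window (δ := δ / (H.range.card + 1)) (by positivity)
  -- A coefficient acting on `γ + η` in the square reads the positions `x + γ = (γ + η) + (x - η)`,
  -- `x ∈ M`.
  obtain ⟨L, hL⟩ := exists_subset_box (hM.image2 (fun x η => x - η) H.range.finite_toSet)
  refine ⟨L, fun ξ ω a γ₀ R φ hω hφ => ?_⟩
  refine ⟨weightedShift (fun _ => 1) (fun _ => norm_one.le) (-γ₀) φ, norm_shift _ _, fun γ => ?_,
    fun x => ?_⟩
  · change (1 : ℂ) * φ (γ + -γ₀) = _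
    rw [one_mul, sub_eq_add_neg]
  classical
  -- The coefficient error is set to `0` where `φ` vanishes anyway, since nothing is known about the
  -- configurations there.
  let d : ℤ × ℤ → ℤ × ℤ → ℂ := fun η γ => if η ∈ H.range ∧ γ + η ∈ box a R then
    H.t η (translateConfig (-(γ + γ₀)) ω) - H.t η (translateConfig (-γ) ξ) else 0
  have hd : ∀ η γ, ‖d η γ‖ ≤ δ / (H.range.card + 1) := by
    intro η γ
    by_cases h : η ∈ H.range ∧ γ + η ∈ box a R
    · simp only [d, if_pos h]
      refine hMH _ _ (fun x hx => ?_) η h.1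
      have h1 := mem_box.1 (hL ⟨x, hx, η, h.1, rfl⟩)
      have h2 := mem_box.1 h.2
      have h3 := hω (x + γ) (by
        rw [mem_box]
        simp only [Prod.fst_add, Prod.snd_add, Prod.fst_sub, Prod.snd_sub] at *
        push_cast at *
        omega)
      simp only [translateConfig, sub_neg_eq_add]
      rw [← h3]
      congr 1; abel
    · simp only [d, if_neg h, norm_zero]
      positivity
  have key : H.op ω (weightedShift (fun _ => 1) (fun _ => norm_one.le) (-γ₀) φ) -
      (x : ℂ) • weightedShift (fun _ => 1) (fun _ => norm_one.le) (-γ₀) φ =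
      weightedShift (fun _ => 1) (fun _ => norm_one.le) (-γ₀)
        (H.op ξ φ - (x : ℂ) • φ + ∑ η ∈ H.range, weightedShift (d η) (hd η) η φ) := by
    ext γ
    change H.op ω _ γ - (x : ℂ) * (1 * φ (γ + -γ₀)) = 1 * (H.op ξ φ (γ + -γ₀) -
      (x : ℂ) * φ (γ + -γ₀) + (∑ η ∈ H.range, weightedShift (d η) (hd η) η φ) (γ + -γ₀))
    rw [H.op_apply, H.op_apply, lp.coeFn_sum, Finset.sum_apply, one_mul, one_mul,
      sub_add_eq_add_sub, ← Finset.sum_add_distrib]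
    congr 1
    refine Finset.sum_congr rfl fun η hη => ?_
    change _ * (1 * φ (γ + η + -γ₀)) = _ + d η (γ + -γ₀) * φ (γ + -γ₀ + η)
    rw [one_mul, add_right_comm γ η]
    by_cases h : γ + -γ₀ + η ∈ box a R
    · simp only [d, if_pos (And.intro hη h), neg_add_cancel_right]
      ring
    · rw [hφ _ h]; ring
  rw [key, norm_shift]
  refine (norm_add_le _ _).trans (add_le_add le_rfl ?_)
  calc _ ≤ ∑ η ∈ H.range, δ / (H.range.card + 1) * ‖φ‖ :=
        norm_sum_le_of_le _ fun η _ => norm_weightedShift_le _ _ _ _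
    _ = H.range.card / (H.range.card + 1) * (δ * ‖φ‖) := by
        rw [Finset.sum_const, nsmul_eq_mul]; ring
    _ ≤ 1 * (δ * ‖φ‖) := by
        gcongr
        rw [div_le_one (by positivity)]; linarith
    _ = δ * ‖φ‖ := one_mul _

/-! ### Comparison of spectra -/

theorem box_subset_box (a : ℤ × ℤ) (R L : ℕ) :
    box a R ⊆ box (a - ((L : ℤ), (L : ℤ))) (R + 2 * L + 1) := by
  intro y hy
  rw [mem_box] at *
  simp only [Prod.fst_sub, Prod.snd_sub]
  push_cast
  omega

/-- The patterns of a legal configuration recur in `ξ`, so its spectrum is part of the essential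
spectrum at `ξ`. -/
theorem realSpectrum_subset_essSpectrum (H : SchrodingerOperator) {ω ξ : Config}
    (hω : IsLegalConfig ω) (hξ : ∀ m, LocallySubst m ξ) :
    realSpectrum (H.op ω) ⊆ essSpectrum (H.op ξ) := by
  intro x hx
  rw [mem_essSpectrum_iff (H.isSelfAdjoint_op ξ)]
  intro ε hε K
  obtain ⟨R, ε', hε', hloc⟩ := H.exists_localization (half_pos hε)
  obtain ⟨L, hL⟩ := H.exists_transplantation (half_pos hε)
  obtain ⟨ψ, -, hψ⟩ := (mem_realSpectrum_iff (H.isSelfAdjoint_op ω)).1 hx ε' hε'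
  obtain ⟨a, ha⟩ := hloc ω x ψ hψ
  obtain ⟨n, c, hn⟩ := hω _ (finite_box (a - ((L : ℤ), (L : ℤ))) (R + 2 * L + 1))
  obtain ⟨γ₀, hK, hγ⟩ := (hξ (n + 2)).exists_occurrence (fun c => hn.forall_letter c)
    K.finite_toSet
  obtain ⟨φ', h1, h2, h3⟩ := hL ω ξ a γ₀ R (cut (box a R) ψ) hγ
    fun γ h => cut_apply_notMem h ψ
  have h4 : ‖H.op ξ φ' - (x : ℂ) • φ'‖ < ε * ‖φ'‖ := by
    refine (h3 x).trans_lt ?_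
    rw [h1]
    linarith
  refine ⟨φ', ?_, fun γ hγK => ?_, h4⟩
  · rintro rfl
    simp at h4
  · rw [h2]
    refine cut_apply_notMem (fun h => ?_) ψ
    have := hK _ (box_subset_box a R L h)
    rw [add_sub_cancel] at this
    exact this hγK

/-- All but finitely many squares in `ξ` carry legal patterns, which occur in `ω`, so the
essential spectrum at `ξ` is part of the spectrum at `ω`. -/
theorem essSpectrum_subset_realSpectrum (H : SchrodingerOperator) {ρ ω ξ : Config}
    (hρ : subst ρ = ρ) (hξ : ξ ∈ (orbitClosure ρ).carrier) (hω : ∀ m, LocallySubst m ω) :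
    essSpectrum (H.op ξ) ⊆ realSpectrum (H.op ω) := by
  intro x hx
  rw [mem_realSpectrum_iff (H.isSelfAdjoint_op ω)]
  intro ε hε
  obtain ⟨R, ε', hε', hloc⟩ := H.exists_localization (half_pos hε)
  obtain ⟨L, hL⟩ := H.exists_transplantation (half_pos hε)
  have hfin := finite_illegal_boxes hρ hξ (R + 2 * L + 1)
  -- A vector vanishing on these inner squares is killed by the cut-off to any square with an
  -- illegal surrounding, and the strict inequality `ha` excludes a zero cut-off.
  have hK := hfin.biUnion fun b _ => finite_box (b + ((L : ℤ), (L : ℤ))) R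
  obtain ⟨ψ, -, hψK, hψ⟩ := (mem_essSpectrum_iff (H.isSelfAdjoint_op ξ)).1 hx ε' hε' hK.toFinset
  obtain ⟨a, ha⟩ := hloc ξ x ψ hψ
  obtain ⟨n, c, hn⟩ : ∃ n c, OccursIn (box (a - ((L : ℤ), (L : ℤ))) (R + 2 * L + 1)) ξ n c := by
    by_contra hcon
    have h0 : cut (box a R) ψ = 0 := by
      ext γ
      change cut (box a R) ψ γ = 0
      by_cases hγ : γ ∈ box a R
      · rw [cut_apply_mem hγ]
        refine hψK γ (hK.mem_toFinset.2 (Set.mem_biUnion (by exact hcon) ?_))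
        rwa [sub_add_cancel]
      · exact cut_apply_notMem hγ ψ
    rw [h0] at ha
    simp at ha
  obtain ⟨γ₀, -, hγ⟩ := (hω (n + 2)).exists_occurrence (fun c => hn.forall_letter c)
    Set.finite_empty
  obtain ⟨φ', h1, -, h3⟩ := hL ξ ω a γ₀ R (cut (box a R) ψ) hγ
    fun γ h => cut_apply_notMem h ψ
  have h4 : ‖H.op ω φ' - (x : ℂ) • φ'‖ < ε * ‖φ'‖ := by
    refine (h3 x).trans_lt ?_
    rw [h1]
    linarith
  refine ⟨φ', ?_, h4⟩
  rintro rfl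
  simp at h4

theorem volume_symmDiff_realSpectrum {E : Type*} [NormedAddCommGroup E] [NormedSpace ℂ E]
    {A A' : E →L[ℂ] E} (h : essSpectrum A = essSpectrum A') :
    MeasureTheory.volume (symmDiff (realSpectrum A) (realSpectrum A')) = 0 := by
  refine MeasureTheory.measure_mono_null ?_
    (((countable_discreteSpectrum A).union (countable_discreteSpectrum A')).measure_zero _)
  have key : ∀ {B B' : E →L[ℂ] E}, essSpectrum B = essSpectrum B' →
      ∀ x ∈ realSpectrum B, x ∉ realSpectrum B' → x ∈ discreteSpectrum B := by
    intro B B' hB x hx hx'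
    by_contra hd
    have : x ∈ essSpectrum B := ⟨hx, hd⟩
    rw [hB] at this
    exact hx' this.1
  rintro x (⟨h1, h2⟩ | ⟨h1, h2⟩)
  · exact .inl (key h x h1 h2)
  · exact .inr (key h.symm x h1 h2)

end ChairTiling

/-! ### Assembly of both assertions -/

theorem corollary2p3 (ω₀ : Config) :
    ∃ (k : ℕ) (ρ : Fin k → Config) (Ω₀ : Subshift),
      -- (a)
      1 ≤ k ∧
      (∀ j, subst (ρ j) = ρ j) ∧
      (∀ j, ∀ d : MetricSpace (ℤ × ℤ), IsConvexMetric d → ∀ (x : ℤ × ℤ) (r : ℝ), 1 ≤ r →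
        ballOf d x r ∩ testDomain = ∅ → IsLegal (restrict (ρ j) (ballOf d x r))) ∧
      Subshift.ConvergesTo (fun n => orbitClosure (subst^[n] ω₀)) Ω₀ ∧
      Ω₀.carrier = ⋃ j, (orbitClosure (ρ j)).carrier ∧
      -- (b)
      ∀ H : SchrodingerOperator, ∀ ξ ∈ Ω₀.carrier, ∀ ω ∈ chairSubshift,
        essSpectrum (H.op ξ) = essSpectrum (H.op ω) ∧
        MeasureTheory.volume
          (symmDiff (realSpectrum (H.op ξ)) (realSpectrum (H.op ω))) = 0 := by
  obtain ⟨k, ρ, hk, hρ⟩ := exists_fin_enumeration (finite_range_substLimit ω₀)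
    (Set.range_nonempty _)
  have hfix : ∀ j, subst (ρ j) = ρ j := by
    intro j
    obtain ⟨u, hu⟩ : ρ j ∈ Set.range fun u : ℤ × ℤ => substLimit fun y => ω₀ (u + y) :=
      hρ ▸ ⟨j, rfl⟩
    rw [← hu]
    exact subst_substLimit _
  refine ⟨k, ρ, unionOrbitClosure hk ρ, hk, hfix, fun j d hd x r _ hT => ?_,
    convergesTo_unionOrbitClosure ω₀ hk hρ, rfl, fun H ξ hξ ω hω => ?_⟩
  · obtain ⟨n, a, h⟩ := exists_occursIn_of_convex (hfix j) (hd.proper x r) (hd.convex x r) hT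
    exact isLegal_restrict (hd.proper x r) h
  · obtain ⟨j, hj⟩ := Set.mem_iUnion.1 hξ
    have hω' := isLegalConfig_of_mem hω
    have heq : essSpectrum (H.op ξ) = essSpectrum (H.op ω) := by
      refine Set.Subset.antisymm ?_ ?_
      -- The second inclusion compares `ω` with itself: its patterns recur off every finite set, so
      -- its whole spectrum is essential.
      · exact (essSpectrum_subset_realSpectrum H (hfix j) hj hω'.locallySubst).trans
          (realSpectrum_subset_essSpectrum H hω' hω'.locallySubst)
      · exact (Set.sdiff_subset : essSpectrum (H.op ω) ⊆ realSpectrum (H.op ω)).trans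
          (realSpectrum_subset_essSpectrum H hω' fun m =>
            (locallySubst_of_fixed (hfix j) m).of_mem_orbitClosure hj)
    exact ⟨heq, volume_symmDiff_realSpectrum heq⟩
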